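/- There is a universal constant $C>0$ such that the following holds. Let $n\ge 0$, let $K\subset\mathbb{R}^n$ be a convex body (a bounded convex set with nonempty interior, which may or may not contain its boundary points), and let $\phi:K\to\mathbb{R}$ be a convex function of class $C^4$ with $D^4\phi(x)[h,h,h,h]\ge 0$ for all $x\in K$ and $h\in\mathbb{R}^n$ (derivatives at boundary points belonging to $K$ are taken relative to $K$). For $x,y\in K$ let $$d_\phi(x,y)=\inf_c\int_0^1\sqrt{c'(t)^{T}\,\nabla^2\phi(c(t))\,c'(t)}\;dt,$$ the infimum being over all $C^1$ curves $c:[0,1]\to K$ with $c(0)=x$, $c(1)=y$; this is the distance induced by the (possibly degenerate) Riemannian metric $\nabla^2\phi$. Let $S_1,S_2,S_3$ be a partition of $K$ into pairwise disjoint, possibly empty, Lebesgue measurable sets, and let $d=\inf_{x\in S_1,\,y\in S_2}d_\phi(x,y)$. Then for every $\alpha>0$, $$\int_{S_3}e^{-\alpha\phi(x)}\,dx\;\ge\;C\sqrt{\alpha}\;d\;\min\left\{\int_{S_1}e^{-\alpha\phi(x)}\,dx,\;\int_{S_2}e^{-\alpha\phi(x)}\,dx\right\},$$ where the right-hand side is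 read as $0$ if $S_1$ or $S_2$ is empty. -/

import Mathlib

open scoped ENNReal

noncomputable section

namespace HessianIsoperimetry

/-- A convex body in `ℝⁿ`: a bounded convex set with nonempty interior. Boundary points may or may
not belong to it, so that both compact bodies and open ones (domains of barrier functions, open
polytopes) are covered. -/
structure IsConvexBody {n : ℕ} (K : Set (EuclideanSpace ℝ (Fin n))) : Prop where
  convex : Convex ℝ K
  bounded : Bornology.IsBounded K
  nonempty_interior : (interior K).Nonempty

/-- The length `√(vᵀ ∇²φ(x) v)` of the tangent vector `v` at `x ∈ K` in the Hessian metric of `φ`.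
Derivatives are taken relative to `K`; at interior points they are the usual ones. -/
def hessianNorm {n : ℕ} (φ : EuclideanSpace ℝ (Fin n) → ℝ) (K : Set (EuclideanSpace ℝ (Fin n)))
    (x v : EuclideanSpace ℝ (Fin n)) : ℝ :=
  Real.sqrt (iteratedFDerivWithin ℝ 2 φ K x (fun _ => v))

/-- The length `∫₀¹ ‖c'(t)‖_{c(t)} dt` of a curve `c : [0,1] → K` in the Hessian metric of `φ`. -/
def curveLength {n : ℕ} (φ : EuclideanSpace ℝ (Fin n) → ℝ) (K : Set (EuclideanSpace ℝ (Fin n)))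
    (c : ℝ → EuclideanSpace ℝ (Fin n)) : ℝ≥0∞ :=
  ∫⁻ t in Set.Icc (0 : ℝ) 1,
    ENNReal.ofReal (hessianNorm φ K (c t) (derivWithin c (Set.Icc (0 : ℝ) 1) t))

/-- `c` restricts to a continuously differentiable curve `[0,1] → K` from `x` to `y`. -/
structure IsCurveIn {n : ℕ} (K : Set (EuclideanSpace ℝ (Fin n)))
    (x y : EuclideanSpace ℝ (Fin n)) (c : ℝ → EuclideanSpace ℝ (Fin n)) : Prop where
  contDiffOn : ContDiffOn ℝ 1 c (Set.Icc (0 : ℝ) 1)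
  mapsTo : Set.MapsTo c (Set.Icc (0 : ℝ) 1) K
  source : c 0 = x
  target : c 1 = y

/-- The Riemannian distance: the infimum of the lengths of all curves in `K` from `x` to `y`. -/
def hessianDist {n : ℕ} (φ : EuclideanSpace ℝ (Fin n) → ℝ) (K : Set (EuclideanSpace ℝ (Fin n)))
    (x y : EuclideanSpace ℝ (Fin n)) : ℝ≥0∞ :=
  ⨅ (c : ℝ → EuclideanSpace ℝ (Fin n)) (_ : IsCurveIn K x y c), curveLength φ K c

/-- The Riemannian distance between two sets. -/
def hessianSetDist {n : ℕ} (φ : EuclideanSpace ℝ (Fin n) → ℝ)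
    (K S T : Set (EuclideanSpace ℝ (Fin n))) : ℝ≥0∞ :=
  ⨅ x ∈ S, ⨅ y ∈ T, hessianDist φ K x y

/-- The mass `∫_S e^{-α φ(x)} dx`. -/
def gibbsMass {n : ℕ} (φ : EuclideanSpace ℝ (Fin n) → ℝ) (α : ℝ)
    (S : Set (EuclideanSpace ℝ (Fin n))) : ℝ≥0∞ :=
  ∫⁻ x in S, ENNReal.ofReal (Real.exp (-(α * φ x)))

end HessianIsoperimetry

end

/-!
The inequality is reduced to dimension one by localization. Only segments are used to bound the
Riemannian distance, so the hypothesis on `d` becomes a lower bound for the Hessian length of every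
segment from `S₁` to `S₂`; after exhausting the interior of `K` by compact convex sets and replacing
`φ` by `ψ = α φ`, all functions involved are uniformly continuous.

*Localization* (`IsUnbalanced.exists_needle`). If the inequality fails on a compact convex set, then
it fails on a convex subset (a needle) whose sections orthogonal to some direction `u` are
arbitrarily small: rotating a half-space about a codimension-two subspace until it bisects one of
the two strict inequalities, one of the two halves retains both. Within a fixed plane of normal
directions the cuts can be made through a point that forces each of them to remove a definite area
from the planar projection, unless the projection is already thin in some direction
(`exists_fat_point`); so thin directions can be produced one after the other until they span a
hyperplane.

*Needles* (`needle_isoperimetry`). On a thin enough needle `ψ` and its Hessian metric depend, up to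
bounded errors, only on `t = ⟪u, x⟫`. The needle is thereby compared with an interval carrying the
density `ρ = e^{-Φ} A`, where `Φ` is the restriction of `ψ` to an axis and `A(t)` is the volume of
the section, which is log-concave by the Prékopa–Leindler inequality
(`satisfiesPrekopaLeindler_pi`).

*The line* (`sqrt_mul_min_tails_le`, `isoperimetry_of_pointwise`). The fourth-order condition says
that `Φ''` is convex, so `Φ'' ≥ Φ''(s)` on one side of any point `s`. On that side `ρ` is dominated
by a Gaussian of curvature `Φ''(s)` times an exponential, and on the other side by the exponential
alone. Whether this exponential decays fast or not, one of the two tails at `s` is at most a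
constant times `ρ(s) / √Φ''(s)`. Integrating this bound outwards from a median of `ρ` gives the
isoperimetric inequality for the metric `√Φ''` on the line.
-/

namespace HessianIsoperimetry

/-! ### The Prékopa–Leindler inequality -/

section PrekopaLeindler

open MeasureTheory Set

/-- One-dimensional Brunn–Minkowski inequality for compact sets: translating so that
`max A = min B = 0` makes `A` and `B` almost disjoint subsets of `A + B`. -/
lemma volume_add_volume_le_of_isCompact {A B C : Set ℝ} (hA : IsCompact A) (hB : IsCompact B)
    (hA0 : A.Nonempty) (hB0 : B.Nonempty) (hC : ∀ a ∈ A, ∀ b ∈ B, a + b ∈ C) :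
    volume A + volume B ≤ volume C := by
  obtain ⟨a, ha, hamax⟩ := hA.exists_isGreatest hA0
  obtain ⟨b, hb, hbmin⟩ := hB.exists_isLeast hB0
  have h1 : volume ((fun x => x + -b) ⁻¹' A) = volume A := measure_preimage_add_right _ _ _
  have h2 : volume ((fun x => -a + x) ⁻¹' B) = volume B := measure_preimage_add _ _ _
  have m2 : MeasurableSet ((fun x => -a + x) ⁻¹' B) :=
    hB.measurableSet.preimage (measurable_const_add _)
  have hd : AEDisjoint volume ((fun x => x + -b) ⁻¹' A) ((fun x => -a + x) ⁻¹' B) := by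
    refine measure_mono_null (t := {a + b}) ?_ (by simp)
    rintro x ⟨hx1, hx2⟩
    have := hamax hx1
    have := hbmin hx2
    simp only [mem_singleton_iff]
    linarith
  rw [← h1, ← h2, ← measure_union₀ m2.nullMeasurableSet hd]
  refine measure_mono ?_
  rintro x (hx | hx)
  · simpa using hC _ hx _ hb
  · simpa using hC _ ha _ hx

lemma volume_add_volume_le {A B C : Set ℝ} (hA : MeasurableSet A) (hB : MeasurableSet B)
    (hA0 : A.Nonempty) (hB0 : B.Nonempty) (hC : ∀ a ∈ A, ∀ b ∈ B, a + b ∈ C) :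
    volume A + volume B ≤ volume C := by
  obtain ⟨a, ha⟩ := hA0
  obtain ⟨b, hb⟩ := hB0
  rw [hA.measure_eq_iSup_isCompact, hB.measure_eq_iSup_isCompact]
  simp only [iSup_and']
  refine ENNReal.biSup_add_biSup_le' ⟨∅, empty_subset _, isCompact_empty⟩
    ⟨∅, empty_subset _, isCompact_empty⟩ ?_
  rintro K ⟨hKA, hK⟩ L ⟨hLB, hL⟩
  refine (add_le_add (measure_mono (subset_insert a K)) (measure_mono (subset_insert b L))).trans ?_
  refine volume_add_volume_le_of_isCompact (hK.insert a) (hL.insert b)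
    (insert_nonempty _ _) (insert_nonempty _ _) ?_
  intro x hx y hy
  exact hC x (insert_subset ha hKA hx) y (insert_subset hb hLB hy)

/-- One-dimensional Brunn–Minkowski inequality for a convex combination of two sets. -/
lemma weighted_volume_add_le {A B C : Set ℝ} (hA : MeasurableSet A) (hB : MeasurableSet B)
    (hA0 : A.Nonempty) (hB0 : B.Nonempty) {s t : ℝ} (hs : 0 < s) (ht : 0 < t)
    (hC : ∀ a ∈ A, ∀ b ∈ B, s * a + t * b ∈ C) :
    ENNReal.ofReal s * volume A + ENNReal.ofReal t * volume B ≤ volume C := by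
  have key : ∀ {r : ℝ}, 0 < r → ∀ S : Set ℝ,
      volume ((fun x => r⁻¹ * x) ⁻¹' S) = ENNReal.ofReal r * volume S := by
    intro r hr S
    rw [Real.volume_preimage_mul_left (inv_ne_zero hr.ne'), inv_inv, abs_of_pos hr]
  rw [← key hs, ← key ht]
  refine volume_add_volume_le (hA.preimage (measurable_const_mul _))
    (hB.preimage (measurable_const_mul _)) ?_ ?_ ?_
  · obtain ⟨a, ha⟩ := hA0
    exact ⟨s * a, by simpa [hs.ne'] using ha⟩
  · obtain ⟨b, hb⟩ := hB0
    exact ⟨t * b, by simpa [ht.ne'] using hb⟩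
  · intro a ha b hb
    have := hC _ ha _ hb
    rwa [mul_inv_cancel_left₀ hs.ne', mul_inv_cancel_left₀ ht.ne'] at this

lemma rpow_mul_rpow_le_weighted_add (a b : ℝ≥0∞) {s t : ℝ} (hs : 0 < s) (ht : 0 < t)
    (hst : s + t = 1) :
    a ^ s * b ^ t ≤ ENNReal.ofReal s * a + ENNReal.ofReal t * b := by
  rcases eq_or_ne a ∞ with rfl | ha
  · simp [ENNReal.mul_top, hs]
  rcases eq_or_ne b ∞ with rfl | hb
  · simp [ENNReal.mul_top, ht]
  have := Real.geom_mean_le_arith_mean2_weighted hs.le ht.le (a.toReal_nonneg) (b.toReal_nonneg) hst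
  have h2 := ENNReal.ofReal_le_ofReal this
  rw [ENNReal.ofReal_mul (by positivity), ENNReal.ofReal_add (by positivity) (by positivity),
    ENNReal.ofReal_mul hs.le, ENNReal.ofReal_mul ht.le,
    ← ENNReal.ofReal_rpow_of_nonneg (by positivity) hs.le,
    ← ENNReal.ofReal_rpow_of_nonneg (by positivity) ht.le,
    ENNReal.ofReal_toReal ha, ENNReal.ofReal_toReal hb] at h2
  exact h2

/-- Additive form of the one-dimensional Prékopa–Leindler inequality for functions with
supremum `1`, by the layer-cake formula and Brunn–Minkowski for the superlevel sets. -/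
lemma weighted_lintegral_add_le {f g h : ℝ → ℝ} (hf : Measurable f) (hg : Measurable g)
    (hh : Measurable h) (hf0 : ∀ x, 0 ≤ f x) (hg0 : ∀ x, 0 ≤ g x) (hh0 : ∀ x, 0 ≤ h x)
    (hf1 : ∀ x, f x ≤ 1) (hg1 : ∀ x, g x ≤ 1)
    (hfs : ∀ r < 1, ∃ x, r < f x) (hgs : ∀ r < 1, ∃ x, r < g x)
    {s t : ℝ} (hs : 0 < s) (ht : 0 < t) (hst : s + t = 1)
    (hfgh : ∀ x y, f x ^ s * g y ^ t ≤ h (s * x + t * y)) :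
    ENNReal.ofReal s * (∫⁻ x, ENNReal.ofReal (f x)) +
        ENNReal.ofReal t * (∫⁻ x, ENNReal.ofReal (g x)) ≤ ∫⁻ x, ENNReal.ofReal (h x) := by
  rw [lintegral_eq_lintegral_meas_lt _ (.of_forall hf0) hf.aemeasurable,
    lintegral_eq_lintegral_meas_lt _ (.of_forall hg0) hg.aemeasurable,
    lintegral_eq_lintegral_meas_lt _ (.of_forall hh0) hh.aemeasurable,
    ← lintegral_const_mul' _ _ ENNReal.ofReal_ne_top,
    ← lintegral_const_mul' _ _ ENNReal.ofReal_ne_top]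
  refine (le_lintegral_add _ _).trans ?_
  refine setLIntegral_mono' measurableSet_Ioi ?_
  intro r hr
  have hr : 0 < r := hr
  rcases le_or_gt 1 r with h1 | h1
  · have e1 : {a | r < f a} = ∅ := by
      ext x; simp only [mem_ofPred_eq, mem_empty_iff_false, iff_false, not_lt]
      exact (hf1 x).trans h1
    have e2 : {a | r < g a} = ∅ := by
      ext x; simp only [mem_ofPred_eq, mem_empty_iff_false, iff_false, not_lt]
      exact (hg1 x).trans h1
    simp [e1, e2]
  · refine weighted_volume_add_le (measurableSet_lt measurable_const hf)
      (measurableSet_lt measurable_const hg) (hfs r h1) (hgs r h1) hs ht ?_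
    intro x hx y hy
    refine lt_of_lt_of_le ?_ (hfgh x y)
    have hx : r < f x := hx
    have hy : r < g y := hy
    calc r = r ^ s * r ^ t := by rw [← Real.rpow_add hr, hst, Real.rpow_one]
      _ < f x ^ s * g y ^ t := by
        have := Real.rpow_lt_rpow hr.le hx hs
        have := Real.rpow_lt_rpow hr.le hy ht
        gcongr

/-- The Prékopa–Leindler inequality as a property of a measure `μ` on a real vector space. -/
def SatisfiesPrekopaLeindler {E : Type*} [AddCommGroup E] [Module ℝ E] [MeasurableSpace E]
    (μ : Measure E) : Prop :=
  ∀ ⦃f g h : E → ℝ≥0∞⦄, Measurable f → Measurable g → Measurable h →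
    ∀ ⦃s t : ℝ⦄, 0 < s → 0 < t → s + t = 1 →
      (∀ x y, f x ^ s * g y ^ t ≤ h (s • x + t • y)) →
        (∫⁻ x, f x ∂μ) ^ s * (∫⁻ x, g x ∂μ) ^ t ≤ ∫⁻ x, h x ∂μ

lemma lintegral_rpow_mul_le_of_bounded {f g h : ℝ → ℝ≥0∞} (hf : Measurable f) (hg : Measurable g)
    (hh : Measurable h) {M : ℝ≥0∞} (hM : M ≠ ∞) (hfM : ∀ x, f x ≤ M) (hgM : ∀ x, g x ≤ M)
    {s t : ℝ} (hs : 0 < s) (ht : 0 < t) (hst : s + t = 1)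
    (hfgh : ∀ x y, f x ^ s * g y ^ t ≤ h (s * x + t * y)) :
    (∫⁻ x, f x) ^ s * (∫⁻ x, g x) ^ t ≤ ∫⁻ x, h x := by
  -- the suprema normalising `f` and `g`
  set F := ⨆ x, f x with hF
  set G := ⨆ x, g x with hG
  have hFt : F ≠ ∞ := ne_top_of_le_ne_top hM (iSup_le hfM)
  have hGt : G ≠ ∞ := ne_top_of_le_ne_top hM (iSup_le hgM)
  rcases eq_or_ne F 0 with hF0 | hF0
  · have : ∀ x, f x = 0 := by simpa [hF] using hF0
    simp [this, hs]
  rcases eq_or_ne G 0 with hG0 | hG0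
  · have : ∀ x, g x = 0 := by simpa [hG] using hG0
    simp [this, ht]
  set H := F ^ s * G ^ t with hH
  have hHt : H ≠ ∞ := ENNReal.mul_ne_top (ENNReal.rpow_ne_top_of_nonneg hs.le hFt)
    (ENNReal.rpow_ne_top_of_nonneg ht.le hGt)
  have hH0 : H ≠ 0 := mul_ne_zero (by simp [hF0, hFt]) (by simp [hG0, hGt])
  have hfF : ∀ x, f x / F ≤ 1 := fun x => ENNReal.div_le_of_le_mul (by
    rw [one_mul]; exact le_iSup f x)
  have hgG : ∀ x, g x / G ≤ 1 := fun x => ENNReal.div_le_of_le_mul (by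
    rw [one_mul]; exact le_iSup g x)
  have hhH : ∀ x, min (h x) H / H ≤ 1 := fun x => ENNReal.div_le_of_le_mul (by
    rw [one_mul]; exact min_le_right _ _)
  have fin : ∀ {a : ℝ≥0∞}, a ≤ 1 → a ≠ ∞ := fun ha => ne_top_of_le_ne_top ENNReal.one_ne_top ha
  have sup : ∀ {k : ℝ → ℝ≥0∞}, (⨆ x, k x) ≠ 0 → (⨆ x, k x) ≠ ∞ → ∀ r < (1:ℝ),
      ∃ x, r < (k x / ⨆ x, k x).toReal := by
    intro k hk0 hkt r hr
    rcases lt_or_ge r 0 with h0 | h0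
    · exact ⟨0, h0.trans_le ENNReal.toReal_nonneg⟩
    have : ENNReal.ofReal r * (⨆ x, k x) < ⨆ x, k x := by
      conv_rhs => rw [← one_mul (⨆ x, k x)]
      exact (ENNReal.mul_lt_mul_iff_left hk0 hkt).2 (by simpa using hr)
    obtain ⟨x, hx⟩ := lt_iSup_iff.1 this
    refine ⟨x, ?_⟩
    have h1 : ENNReal.ofReal r < k x / ⨆ x, k x :=
      (ENNReal.lt_div_iff_mul_lt (Or.inl hk0) (Or.inl hkt)).2 hx
    exact (ENNReal.ofReal_lt_iff_lt_toReal h0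
      (ENNReal.div_ne_top (ne_top_of_le_ne_top hkt (le_iSup k x)) hk0)).1 h1
  have main := weighted_lintegral_add_le (f := fun x => (f x / F).toReal)
    (g := fun x => (g x / G).toReal) (h := fun x => (min (h x) H / H).toReal)
    (by fun_prop) (by fun_prop) (by fun_prop) (fun _ => ENNReal.toReal_nonneg)
    (fun _ => ENNReal.toReal_nonneg) (fun _ => ENNReal.toReal_nonneg)
    (fun x => ENNReal.toReal_mono ENNReal.one_ne_top (hfF x))
    (fun x => ENNReal.toReal_mono ENNReal.one_ne_top (hgG x))
    (sup hF0 hFt) (sup hG0 hGt) hs ht hst (by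
      intro x y
      rw [ENNReal.toReal_rpow, ENNReal.toReal_rpow, ← ENNReal.toReal_mul]
      refine ENNReal.toReal_mono (fin (hhH _)) ?_
      rw [ENNReal.div_rpow_of_nonneg _ _ hs.le, ENNReal.div_rpow_of_nonneg _ _ ht.le,
        div_eq_mul_inv, div_eq_mul_inv, mul_mul_mul_comm, ← ENNReal.mul_inv (by simp [hF0, hFt])
        (by simp [hF0, hFt]), ← div_eq_mul_inv]
      refine ENNReal.div_le_div_right (le_min (hfgh x y) ?_) _
      exact mul_le_mul' (ENNReal.rpow_le_rpow (le_iSup f x) hs.le)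
        (ENNReal.rpow_le_rpow (le_iSup g y) ht.le))
  simp only [ENNReal.ofReal_toReal (fin (hfF _)), ENNReal.ofReal_toReal (fin (hgG _)),
    ENNReal.ofReal_toReal (fin (hhH _))] at main
  simp only [div_eq_mul_inv] at main
  rw [lintegral_mul_const _ hf, lintegral_mul_const _ hg,
    lintegral_mul_const _ (hh.min measurable_const)] at main
  have h1 := (rpow_mul_rpow_le_weighted_add _ _ hs ht hst).trans main
  rw [ENNReal.mul_rpow_of_nonneg _ _ hs.le, ENNReal.mul_rpow_of_nonneg _ _ ht.le,
    mul_mul_mul_comm, ENNReal.inv_rpow, ENNReal.inv_rpow, ← ENNReal.mul_inv (by simp [hF0, hFt])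
        (by simp [hF0, hFt]), ← div_eq_mul_inv, ← div_eq_mul_inv] at h1
  have h2 := (ENNReal.div_le_iff hH0 hHt).1 h1
  rw [ENNReal.div_mul_cancel hH0 hHt] at h2
  exact h2.trans (lintegral_mono fun x => min_le_left _ _)

theorem satisfiesPrekopaLeindler_real : SatisfiesPrekopaLeindler (volume : Measure ℝ) := by
  intro f g h hf hg hh s t hs ht hst hfgh
  rcases eq_or_ne (∫⁻ x, f x) 0 with hF0 | hF0
  · simp [hF0, hs]
  rcases eq_or_ne (∫⁻ x, g x) 0 with hG0 | hG0
  · simp [hG0, ht]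
  have tr : ∀ {k : ℝ → ℝ≥0∞}, Measurable k → Filter.Tendsto (fun n : ℕ => ∫⁻ x, min (k x) n)
      Filter.atTop (nhds (∫⁻ x, k x)) := by
    intro k hk
    refine lintegral_tendsto_of_tendsto_of_monotone
      (fun n => (hk.min measurable_const).aemeasurable) (.of_forall fun x => ?_)
      (.of_forall fun x => ?_)
    · intro m n hmn
      exact min_le_min le_rfl (by exact_mod_cast hmn)
    · have := (tendsto_const_nhds (x := k x)).min ENNReal.tendsto_nat_nhds_top
      simpa using this
  refine le_of_tendsto' (ENNReal.Tendsto.mul ((tr hf).ennrpow_const s)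
    (Or.inl (by simp [hF0, hs.not_gt]))
    ((tr hg).ennrpow_const t) (Or.inl (by simp [hG0, ht.not_gt]))) ?_
  intro n
  refine lintegral_rpow_mul_le_of_bounded (hf.min measurable_const) (hg.min measurable_const) hh
    (ENNReal.natCast_ne_top n) (fun x => min_le_right _ _) (fun x => min_le_right _ _) hs ht hst ?_
  intro x y
  refine le_trans ?_ (hfgh x y)
  exact mul_le_mul' (ENNReal.rpow_le_rpow (min_le_left _ _) hs.le)
    (ENNReal.rpow_le_rpow (min_le_left _ _) ht.le)

lemma SatisfiesPrekopaLeindler.prod {E F : Type*} [AddCommGroup E] [Module ℝ E] [MeasurableSpace E]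
    [AddCommGroup F] [Module ℝ F] [MeasurableSpace F] {μ : Measure E} {ν : Measure F} [SFinite ν]
    (hμ : SatisfiesPrekopaLeindler μ) (hν : SatisfiesPrekopaLeindler ν) :
    SatisfiesPrekopaLeindler (μ.prod ν) := by
  intro f g h hf hg hh s t hs ht hst hfgh
  rw [lintegral_prod _ hf.aemeasurable, lintegral_prod _ hg.aemeasurable,
    lintegral_prod _ hh.aemeasurable]
  refine hμ hf.lintegral_prod_right' hg.lintegral_prod_right' hh.lintegral_prod_right' hs ht hst ?_
  intro x y
  exact hν (hf.comp measurable_prodMk_left) (hg.comp measurable_prodMk_left)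
    (hh.comp measurable_prodMk_left) hs ht hst (fun u v => hfgh (x, u) (y, v))

lemma SatisfiesPrekopaLeindler.of_measurePreserving {E F : Type*} [AddCommGroup E] [Module ℝ E]
    [MeasurableSpace E] [AddCommGroup F] [Module ℝ F] [MeasurableSpace F] {μ : Measure E}
    {ν : Measure F} (hμ : SatisfiesPrekopaLeindler μ) (e : E →ₗ[ℝ] F)
    (he : MeasurePreserving e μ ν) : SatisfiesPrekopaLeindler ν := by
  intro f g h hf hg hh s t hs ht hst hfgh
  rw [← he.lintegral_comp hf, ← he.lintegral_comp hg, ← he.lintegral_comp hh]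
  refine hμ (hf.comp he.measurable) (hg.comp he.measurable) (hh.comp he.measurable) hs ht hst ?_
  intro x y
  have := hfgh (e x) (e y)
  rwa [← map_smul, ← map_smul, ← map_add] at this

theorem satisfiesPrekopaLeindler_pi (m : ℕ) :
    SatisfiesPrekopaLeindler (volume : Measure (Fin m → ℝ)) := by
  induction m with
  | zero =>
    intro f g h hf hg hh s t hs ht hst hfgh
    rw [Measure.volume_pi_eq_dirac]
    simp only [lintegral_dirac' _ hf, lintegral_dirac' _ hg, lintegral_dirac' _ hh]
    convert hfgh _ _
  | succ m ih =>
    have he := (volume_preserving_piFinSuccAbove (fun _ : Fin (m + 1) => ℝ) 0).symm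
    have hp : SatisfiesPrekopaLeindler (volume : Measure (ℝ × (Fin m → ℝ))) :=
      satisfiesPrekopaLeindler_real.prod ih
    let e : (ℝ × (Fin m → ℝ)) →ₗ[ℝ] (Fin (m + 1) → ℝ) :=
      { toFun := fun p => (MeasurableEquiv.piFinSuccAbove (fun _ : Fin (m + 1) => ℝ) 0).symm p
        map_add' := by
          intro p q
          ext i
          refine Fin.cases ?_ (fun j => ?_) i <;> simp [MeasurableEquiv.piFinSuccAbove]
        map_smul' := by
          intro c p
          ext i
          refine Fin.cases ?_ (fun j => ?_) i <;> simp [MeasurableEquiv.piFinSuccAbove] }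
    exact hp.of_measurePreserving e he

end PrekopaLeindler

/-! ### Localization to thin convex needles -/

section Localization

open MeasureTheory Set Filter Topology
open scoped RealInnerProductSpace

variable {E : Type*} [NormedAddCommGroup E] [InnerProductSpace ℝ E] [FiniteDimensional ℝ E]
  [MeasurableSpace E] [BorelSpace E]

lemma volume_inner_eq_zero {v : E} (hv : v ≠ 0) (r : ℝ) : volume {x : E | ⟪v, x⟫ = r} = 0 := by
  rcases eq_empty_or_nonempty {x : E | ⟪v, x⟫ = r} with h | ⟨x₀, hx₀⟩
  · rw [h, measure_empty]
  have hx₀ : ⟪v, x₀⟫ = r := hx₀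
  have : {x : E | ⟪v, x⟫ = r} = (fun x => x + -x₀) ⁻¹' ((ℝ ∙ v)ᗮ : Submodule ℝ E) := by
    ext x
    simp only [mem_ofPred_eq, mem_preimage, SetLike.mem_coe,
      Submodule.mem_orthogonal_singleton_iff_inner_right, inner_add_right, inner_neg_right, hx₀]
    constructor <;> intro h <;> linarith
  rw [this, measure_preimage_add_right]
  refine Measure.addHaar_submodule _ _ fun h => hv ?_
  have : v ∈ (ℝ ∙ v)ᗮ := h ▸ Submodule.mem_top
  rw [Submodule.mem_orthogonal_singleton_iff_inner_right] at this
  exact inner_self_eq_zero.1 this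

/-- A compact convex set on which `ν₃` is smaller than both `ν₁` and `ν₂`; the property that
survives a suitable halving. -/
structure IsUnbalanced (ν₁ ν₂ ν₃ : Measure E) (N : Set E) : Prop where
  isCompact : IsCompact N
  convex : Convex ℝ N
  lt_left : ν₃ N < ν₁ N
  lt_right : ν₃ N < ν₂ N

/-- Rotating a half-space about a codimension-two subspace until it bisects `ν₁ - ν₃` yields a half
on which `ν₂ - ν₃` is positive as well. -/
lemma IsUnbalanced.exists_cut {ν₁ ν₂ ν₃ : Measure E} [IsFiniteMeasure ν₁] [IsFiniteMeasure ν₂]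
    [IsFiniteMeasure ν₃] (h₁ : ν₁ ≪ volume) (h₂ : ν₂ ≪ volume) (h₃ : ν₃ ≪ volume) {N : Set E}
    (hN : IsUnbalanced ν₁ ν₂ ν₃ N) {e₁ e₂ : E} (he₁ : ‖e₁‖ = 1) (he₂ : ‖e₂‖ = 1)
    (he : ⟪e₁, e₂⟫ = 0) (p q : ℝ) :
    ∃ c s : ℝ, c ^ 2 + s ^ 2 = 1 ∧
      IsUnbalanced ν₁ ν₂ ν₃ (N ∩ {x | ⟪c • e₁ + s • e₂, x⟫ ≤ c * p + s * q}) := by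
  set v : ℝ → E := fun θ => Real.cos θ • e₁ + Real.sin θ • e₂ with hv
  set r : ℝ → ℝ := fun θ => Real.cos θ * p + Real.sin θ * q with hr
  have hv0 : ∀ θ, v θ ≠ 0 := by
    intro θ h0
    have : ⟪v θ, v θ⟫ = 1 := by
      simp only [hv, inner_add_left, inner_add_right, inner_smul_left, inner_smul_right, he,
        real_inner_comm e₁ e₂, real_inner_self_eq_norm_sq, he₁, he₂]
      have := Real.cos_sq_add_sin_sq θ
      simp only [conj_trivial]
      linear_combination this
    rw [h0] at this
    simp at this
  have hvc : Continuous v := by fun_prop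
  have hrc : Continuous r := by fun_prop
  have hvpi : ∀ θ, v (θ + Real.pi) = -v θ := by
    intro θ; simp only [hv, Real.cos_add_pi, Real.sin_add_pi]; module
  have hrpi : ∀ θ, r (θ + Real.pi) = -r θ := by
    intro θ; simp only [hr, Real.cos_add_pi, Real.sin_add_pi]; ring
  set H : ℝ → Set E := fun θ => N ∩ {x | ⟪v θ, x⟫ ≤ r θ} with hH
  have hHm : ∀ θ, MeasurableSet (H θ) := fun θ => hN.isCompact.measurableSet.inter
    (measurableSet_le (by fun_prop) measurable_const)
  have hadd : ∀ ν : Measure E, ν ≪ volume → ∀ θ, ν N = ν (H θ) + ν (H (θ + Real.pi)) := by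
    intro ν hν θ
    rw [← measure_union₀ (hHm _).nullMeasurableSet]
    · congr 1
      ext x
      simp only [hH, mem_union, mem_inter_iff, mem_ofPred_eq, hvpi, hrpi, inner_neg_left]
      constructor
      · intro hx
        rcases le_total (⟪v θ, x⟫) (r θ) with h | h
        · exact Or.inl ⟨hx, h⟩
        · exact Or.inr ⟨hx, by linarith⟩
      · rintro (h | h)
        exacts [h.1, h.1]
    · refine hν (measure_mono_null ?_ (volume_inner_eq_zero (hv0 θ) (r θ)))
      rintro x ⟨⟨-, hx1⟩, ⟨-, hx2⟩⟩
      simp only [mem_ofPred_eq, hvpi, hrpi, inner_neg_left] at hx1 hx2 ⊢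
      linarith
  have hcont : ∀ ν : Measure E, ν ≪ volume → IsFiniteMeasure ν →
      Continuous fun θ => (ν (H θ)).toReal := by
    intro ν hν hfin
    rw [continuous_iff_continuousAt]
    intro θ₀
    refine (ENNReal.tendsto_toReal (measure_ne_top ν _)).comp ?_
    refine tendsto_measure_of_ae_tendsto_indicator _ (hHm θ₀) hHm MeasurableSet.univ
      (measure_ne_top _ _) (.of_forall fun _ => subset_univ _) ?_
    have : ∀ᵐ x ∂ν, ⟪v θ₀, x⟫ ≠ r θ₀ := by
      rw [ae_iff]
      simpa using hν (volume_inner_eq_zero (hv0 θ₀) (r θ₀))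
    filter_upwards [this] with x hx
    have c1 : Continuous fun θ => ⟪v θ, x⟫ := by fun_prop
    rcases lt_or_gt_of_ne hx with h | h
    · filter_upwards [c1.continuousAt.eventually_lt hrc.continuousAt h] with θ hθ
      simp only [hH, mem_inter_iff, mem_ofPred_eq, hθ.le, h.le]
    · filter_upwards [hrc.continuousAt.eventually_lt c1.continuousAt h] with θ hθ
      simp only [hH, mem_inter_iff, mem_ofPred_eq, not_le.2 hθ, not_le.2 h]
  have haddR : ∀ ν : Measure E, ν ≪ volume → IsFiniteMeasure ν → ∀ θ,
      (ν N).toReal = (ν (H θ)).toReal + (ν (H (θ + Real.pi))).toReal := by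
    intro ν hν hfin θ
    rw [hadd ν hν θ, ENNReal.toReal_add (measure_ne_top _ _) (measure_ne_top _ _)]
  have hc : Continuous fun θ => (ν₁ (H θ)).toReal - (ν₃ (H θ)).toReal :=
    (hcont ν₁ h₁ inferInstance).sub (hcont ν₃ h₃ inferInstance)
  have hI : ((ν₁ N).toReal - (ν₃ N).toReal) / 2 ∈
      uIcc ((ν₁ (H 0)).toReal - (ν₃ (H 0)).toReal)
        ((ν₁ (H (0 + Real.pi))).toReal - (ν₃ (H (0 + Real.pi))).toReal) := by
    have a1 := haddR ν₁ h₁ inferInstance 0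
    have a3 := haddR ν₃ h₃ inferInstance 0
    rw [mem_uIcc]
    rcases le_total ((ν₁ (H 0)).toReal - (ν₃ (H 0)).toReal)
      ((ν₁ (H (0 + Real.pi))).toReal - (ν₃ (H (0 + Real.pi))).toReal) with h | h
    · left; constructor <;> linarith
    · right; constructor <;> linarith
  obtain ⟨θ, -, hθ⟩ := intermediate_value_uIcc hc.continuousOn hI
  have l1 := (ENNReal.toReal_lt_toReal (measure_ne_top _ _) (measure_ne_top _ _)).2 hN.lt_left
  have l2 := (ENNReal.toReal_lt_toReal (measure_ne_top _ _) (measure_ne_top _ _)).2 hN.lt_right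
  have a1 := haddR ν₁ h₁ inferInstance θ
  have a2 := haddR ν₂ h₂ inferInstance θ
  have a3 := haddR ν₃ h₃ inferInstance θ
  have fin : ∀ θ', (ν₃ (H θ')).toReal < (ν₁ (H θ')).toReal →
      (ν₃ (H θ')).toReal < (ν₂ (H θ')).toReal →
      ∃ c s : ℝ, c ^ 2 + s ^ 2 = 1 ∧
      IsUnbalanced ν₁ ν₂ ν₃ (N ∩ {x | ⟪c • e₁ + s • e₂, x⟫ ≤ c * p + s * q}) := by
    intro θ' b1 b2
    refine ⟨Real.cos θ', Real.sin θ', Real.cos_sq_add_sin_sq θ', ?_, ?_, ?_, ?_⟩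
    · exact hN.isCompact.inter_right (isClosed_le (by fun_prop) (by fun_prop))
    · exact hN.convex.inter (convex_halfSpace_le
        (innerSL ℝ (v θ')).toLinearMap.isLinear _)
    · exact (ENNReal.toReal_lt_toReal (measure_ne_top _ _) (measure_ne_top _ _)).1 b1
    · exact (ENNReal.toReal_lt_toReal (measure_ne_top _ _) (measure_ne_top _ _)).1 b2
  simp only at hθ
  rcases lt_or_ge (ν₃ (H θ)).toReal (ν₂ (H θ)).toReal with h | h
  · exact fin θ (by linarith) h
  · exact fin (θ + Real.pi) (by linarith) (by linarith)

/-- A planar convex set of width greater than `ε` in every direction contains a point `p` such that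
every half-plane bounded by a line through `p` contains a definite part of the set. The point `p` is
the centroid of a fat triangle. -/
lemma exists_fat_point {Q : Set (Fin 2 → ℝ)} (hQ : Convex ℝ Q) {ε : ℝ} (hε : 0 < ε)
    (hw : ∀ c s : ℝ, c ^ 2 + s ^ 2 = 1 → ∃ x ∈ Q, ∃ y ∈ Q,
      ε < c * (x 0 - y 0) + s * (x 1 - y 1)) :
    ∃ p : Fin 2 → ℝ, ∀ c s : ℝ, c ^ 2 + s ^ 2 = 1 →
      ENNReal.ofReal (ε ^ 2 / 72) ≤ volume (Q ∩ {x | c * p 0 + s * p 1 < c * x 0 + s * x 1}) := by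
  obtain ⟨y, hy, x, hx, hxy⟩ := hw 1 0 (by norm_num)
  -- `a`, `b` are edge vectors of a triangle with vertex `x`
  obtain ⟨a, ha⟩ : ∃ a, a = y - x := ⟨_, rfl⟩
  have ha0 : ε < a 0 := by simpa [ha] using hxy
  set L := Real.sqrt (a 0 ^ 2 + a 1 ^ 2) with hL
  have hLsq : L ^ 2 = a 0 ^ 2 + a 1 ^ 2 := Real.sq_sqrt (by positivity)
  have hL0 : ε < L := by
    apply Real.lt_sqrt_of_sq_lt
    nlinarith [sq_nonneg (a 1)]
  have hLpos : 0 < L := hε.trans hL0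
  obtain ⟨z, hz, w, hw', hzw⟩ := hw (-a 1 / L) (a 0 / L) (by
    field_simp; rw [hLsq]; ring)
  have hzw2 : ε * L < -a 1 * (z 0 - w 0) + a 0 * (z 1 - w 1) := by
    have : -a 1 / L * (z 0 - w 0) + a 0 / L * (z 1 - w 1)
      = (-a 1 * (z 0 - w 0) + a 0 * (z 1 - w 1)) / L := by ring
    rw [this, lt_div_iff₀ hLpos] at hzw
    exact hzw
  obtain ⟨b, hxb, hdet⟩ : ∃ b : Fin 2 → ℝ, x + b ∈ Q ∧ ε ^ 2 / 2 < |a 0 * b 1 - a 1 * b 0| := by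
    have hεL : ε ^ 2 < ε * L := by nlinarith
    by_cases hcase : ε * L / 2 < |a 0 * (z - x) 1 - a 1 * (z - x) 0|
    · exact ⟨z - x, by simpa using hz, by linarith⟩
    · refine ⟨w - x, by simpa using hw', ?_⟩
      simp only [Pi.sub_apply, not_lt] at hcase ⊢
      have h1 := (abs_le.1 hcase).2
      rw [lt_abs]
      right
      linarith
  have hxa : x + a ∈ Q := by rw [ha]; simpa using hy
  refine ⟨x + (1 / 3 : ℝ) • (a + b), fun c s hcs => ?_⟩
  set l : (Fin 2 → ℝ) → ℝ := fun u => c * u 0 + s * u 1 with hl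
  -- signs making the linear functional nonnegative on both edges
  obtain ⟨σ, hσ, hσa⟩ : ∃ σ : ℝ, (σ = 1 ∨ σ = -1) ∧ 0 ≤ σ * l a := by
    rcases le_total 0 (l a) with h | h
    · exact ⟨1, Or.inl rfl, by linarith⟩
    · exact ⟨-1, Or.inr rfl, by linarith⟩
  obtain ⟨τ, hτ, hτb⟩ : ∃ τ : ℝ, (τ = 1 ∨ τ = -1) ∧ 0 ≤ τ * l b := by
    rcases le_total 0 (l b) with h | h
    · exact ⟨1, Or.inl rfl, by linarith⟩
    · exact ⟨-1, Or.inr rfl, by linarith⟩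
  have hne : 0 < σ * l a ∨ 0 < τ * l b := by
    by_contra! hcon
    have e1 : l a = 0 := by rcases hσ with rfl | rfl <;> linarith
    have e2 : l b = 0 := by rcases hτ with rfl | rfl <;> linarith
    simp only [hl] at e1 e2
    have d1 : (a 0 * b 1 - a 1 * b 0) * c = 0 := by linear_combination b 1 * e1 - a 1 * e2
    have d2 : (a 0 * b 1 - a 1 * b 0) * s = 0 := by linear_combination a 0 * e2 - b 0 * e1
    have : (a 0 * b 1 - a 1 * b 0) = 0 := by
      linear_combination c * d1 + s * d2 - (a 0 * b 1 - a 1 * b 0) * hcs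
    rw [this, abs_zero] at hdet
    nlinarith [sq_nonneg ε]
  set M : Matrix (Fin 2) (Fin 2) ℝ := !![σ * a 0, τ * b 0; σ * a 1, τ * b 1] with hM
  set box : Set (Fin 2 → ℝ) := univ.pi fun _ => Ioo (0 : ℝ) (1 / 6) with hbox
  have hdetM : |M.det| = |a 0 * b 1 - a 1 * b 0| := by
    rw [hM, Matrix.det_fin_two_of]
    rcases hσ with rfl | rfl <;> rcases hτ with rfl | rfl
    · congr 1; ring
    · rw [← abs_neg]; congr 1; ring
    · rw [← abs_neg]; congr 1; ring
    · congr 1; ring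
  have hvol : volume (Matrix.toLin' M '' box) = ENNReal.ofReal (|a 0 * b 1 - a 1 * b 0| / 36) := by
    rw [Measure.addHaar_image_linearMap, LinearMap.det_toLin', hdetM, hbox, Real.volume_pi_Ioo,
      Fin.prod_univ_two, ← ENNReal.ofReal_mul (by norm_num), ← ENNReal.ofReal_mul (abs_nonneg _)]
    congr 1; ring
  calc ENNReal.ofReal (ε ^ 2 / 72) ≤ volume (Matrix.toLin' M '' box) := by
        rw [hvol]; exact ENNReal.ofReal_le_ofReal (by linarith)
    _ ≤ volume ((fun u => (x + (1 / 3 : ℝ) • (a + b)) + u) ⁻¹'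
          (Q ∩ {u | c * (x + (1 / 3 : ℝ) • (a + b)) 0 + s * (x + (1 / 3 : ℝ) • (a + b)) 1
            < c * u 0 + s * u 1})) := by
        refine measure_mono ?_
        rintro _ ⟨t, ht, rfl⟩
        have ht0 := ht 0 (mem_univ _)
        have ht1 := ht 1 (mem_univ _)
        simp only [mem_Ioo] at ht0 ht1
        have eM : Matrix.toLin' M t = (σ * t 0) • a + (τ * t 1) • b := by
          ext i
          fin_cases i <;> simp [hM, Matrix.mulVec, dotProduct, Fin.sum_univ_two] <;> ring
        rw [eM]
        refine ⟨?_, ?_⟩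
        · have e : x + (1 / 3 : ℝ) • (a + b) + ((σ * t 0) • a + (τ * t 1) • b)
            = (1 / 3 - σ * t 0 - τ * t 1) • x + (1 / 3 + σ * t 0) • (x + a)
              + (1 / 3 + τ * t 1) • (x + b) := by module
          beta_reduce
          rw [e]
          have hs1 : |σ * t 0| ≤ 1 / 6 := by
            rcases hσ with rfl | rfl <;> rw [abs_le] <;> constructor <;> linarith
          have hs2 : |τ * t 1| ≤ 1 / 6 := by
            rcases hτ with rfl | rfl <;> rw [abs_le] <;> constructor <;> linarith
          rw [abs_le] at hs1 hs2
          have hp : 0 < (1 / 3 - σ * t 0 - τ * t 1) + (1 / 3 + σ * t 0) := by linarith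
          have h1 : 0 ≤ 1 / 3 - σ * t 0 - τ * t 1 := by linarith
          have h2 : 0 ≤ 1 / 3 + σ * t 0 := by linarith
          have hmid := convex_iff_div.1 hQ hx hxa h1 h2 hp
          have := hQ hmid hxb hp.le (b := 1 / 3 + τ * t 1) (by linarith) (by ring)
          rw [smul_add, smul_smul, smul_smul, mul_div_cancel₀ _ hp.ne',
            mul_div_cancel₀ _ hp.ne'] at this
          exact this
        · have : 0 < t 0 * (σ * l a) + t 1 * (τ * l b) := by
            rcases hne with h | h
            · have := mul_pos ht0.1 h
              have := mul_nonneg ht1.1.le hτb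
              linarith
            · have := mul_nonneg ht0.1.le hσa
              have := mul_pos ht1.1 h
              linarith
          simp only [hl] at this
          simp only [mem_ofPred_eq, Pi.add_apply, Pi.smul_apply, smul_eq_mul]
          linarith
    _ = _ := measure_preimage_add _ _ _

/-- Cutting repeatedly by half-spaces with normals in a plane makes an unbalanced set thin in some
direction of that plane, since otherwise each cut removes a fixed amount of area from the projection
to the plane. -/
lemma IsUnbalanced.exists_thin_in_plane {ν₁ ν₂ ν₃ : Measure E} [IsFiniteMeasure ν₁]
    [IsFiniteMeasure ν₂] [IsFiniteMeasure ν₃] (h₁ : ν₁ ≪ volume) (h₂ : ν₂ ≪ volume)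
    (h₃ : ν₃ ≪ volume) {N : Set E} (hN : IsUnbalanced ν₁ ν₂ ν₃ N) {e₁ e₂ : E} (he₁ : ‖e₁‖ = 1)
    (he₂ : ‖e₂‖ = 1) (he : ⟪e₁, e₂⟫ = 0) {ε : ℝ} (hε : 0 < ε) :
    ∃ N' ⊆ N, IsUnbalanced ν₁ ν₂ ν₃ N' ∧ ∃ c s : ℝ, c ^ 2 + s ^ 2 = 1 ∧
      ∀ x ∈ N', ∀ y ∈ N', ⟪c • e₁ + s • e₂, x - y⟫ ≤ ε := by
  set P : E → (Fin 2 → ℝ) := fun x => ![⟪e₁, x⟫, ⟪e₂, x⟫] with hP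
  have hPc : Continuous P := by
    refine continuous_pi fun i => ?_
    fin_cases i <;> simp [hP] <;> fun_prop
  have hPl : IsLinearMap ℝ P := by
    constructor
    · intro x y; ext i; fin_cases i <;> simp [hP, inner_add_right]
    · intro r x; ext i; fin_cases i <;> simp [hP, inner_smul_right]
  set δ := ε ^ 2 / 72 with hδ
  have hδ0 : 0 < δ := by positivity
  have hin : ∀ c s x, ⟪c • e₁ + s • e₂, x⟫ = c * P x 0 + s * P x 1 := by
    intro c s x; simp [hP, inner_add_left, inner_smul_left]
  have key : ∀ k : ℕ, ∀ N : Set E, IsUnbalanced ν₁ ν₂ ν₃ N →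
      volume (P '' N) < ENNReal.ofReal (k * δ) →
      ∃ N' ⊆ N, IsUnbalanced ν₁ ν₂ ν₃ N' ∧ ∃ c s : ℝ, c ^ 2 + s ^ 2 = 1 ∧
      ∀ x ∈ N', ∀ y ∈ N', ⟪c • e₁ + s • e₂, x - y⟫ ≤ ε := by
    intro k
    induction k with
    | zero => intro N _ h; simp at h
    | succ k ih =>
      intro N hN hvol
      by_cases hthin : ∃ c s : ℝ, c ^ 2 + s ^ 2 = 1 ∧
        ∀ x ∈ N, ∀ y ∈ N, ⟪c • e₁ + s • e₂, x - y⟫ ≤ ε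
      · exact ⟨N, subset_rfl, hN, hthin⟩
      push Not at hthin
      obtain ⟨p, hp⟩ := exists_fat_point (Q := P '' N) (hN.convex.is_linear_image hPl) hε (by
        intro c s hcs
        obtain ⟨x, hx, y, hy, hxy⟩ := hthin c s hcs
        refine ⟨P x, mem_image_of_mem _ hx, P y, mem_image_of_mem _ hy, ?_⟩
        rw [inner_sub_right, hin, hin] at hxy
        linarith)
      obtain ⟨c, s, hcs, hN'⟩ := hN.exists_cut h₁ h₂ h₃ he₁ he₂ he (p 0) (p 1)
      set N₁ := N ∩ {x | ⟪c • e₁ + s • e₂, x⟫ ≤ c * p 0 + s * p 1} with hN₁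
      have hsub : P '' N₁ ∪ (P '' N ∩ {x | c * p 0 + s * p 1 < c * x 0 + s * x 1}) ⊆ P '' N :=
        union_subset (image_mono inter_subset_left) inter_subset_left
      have hdisj : Disjoint (P '' N₁) (P '' N ∩ {x | c * p 0 + s * p 1 < c * x 0 + s * x 1}) := by
        rw [Set.disjoint_left]
        rintro _ ⟨x, ⟨-, hx⟩, rfl⟩ ⟨-, hx2⟩
        simp only [mem_ofPred_eq, hin] at hx hx2
        linarith
      have hmeas : MeasurableSet (P '' N₁) := (hN'.isCompact.image hPc).measurableSet
      have hle := measure_mono (μ := volume) hsub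
      rw [measure_union' hdisj hmeas] at hle
      have h1 : volume (P '' N₁) + ENNReal.ofReal δ
          < ENNReal.ofReal (k * δ) + ENNReal.ofReal δ := by
        rw [← ENNReal.ofReal_add (by positivity) hδ0.le]
        refine lt_of_le_of_lt ((add_le_add_right (hp c s hcs) _).trans hle) (hvol.trans_le ?_)
        push_cast
        exact ENNReal.ofReal_le_ofReal (by linarith)
      obtain ⟨N', hN's, hh⟩ := ih N₁ hN' ((ENNReal.add_lt_add_iff_right ENNReal.ofReal_ne_top).1 h1)
      exact ⟨N', hN's.trans inter_subset_left, hh⟩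
  have hfin : volume (P '' N) ≠ ∞ := (hN.isCompact.image hPc).measure_lt_top.ne
  obtain ⟨k, hk⟩ := exists_nat_gt ((volume (P '' N)).toReal / δ)
  refine key k N hN ?_
  rw [div_lt_iff₀ hδ0] at hk
  exact (ENNReal.lt_ofReal_iff_toReal_lt hfin).2 hk

/-- Localization: an unbalanced set contains an unbalanced needle, all of whose sections orthogonal
to some direction `u` have small diameter. -/
theorem IsUnbalanced.exists_needle {ν₁ ν₂ ν₃ : Measure E} [IsFiniteMeasure ν₁]
    [IsFiniteMeasure ν₂] [IsFiniteMeasure ν₃] (h₁ : ν₁ ≪ volume) (h₂ : ν₂ ≪ volume)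
    (h₃ : ν₃ ≪ volume) {K : Set E} (hK : IsUnbalanced ν₁ ν₂ ν₃ K)
    (hdim : 0 < Module.finrank ℝ E) {ε : ℝ} (hε : 0 < ε) :
    ∃ N ⊆ K, IsUnbalanced ν₁ ν₂ ν₃ N ∧ ∃ u : E, ‖u‖ = 1 ∧
      ∀ x ∈ N, ∀ y ∈ N, ⟪u, x⟫ = ⟪u, y⟫ → ‖x - y‖ ≤ ε := by
  obtain ⟨m, hm⟩ : ∃ m, Module.finrank ℝ E = m + 1 := ⟨_, (Nat.succ_pred_eq_of_pos hdim).symm⟩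
  set η := ε / (m + 1) with hη
  have hη0 : 0 < η := by positivity
  have key : ∀ k ≤ m, ∃ N ⊆ K, IsUnbalanced ν₁ ν₂ ν₃ N ∧ ∃ W : Submodule ℝ E,
      Module.finrank ℝ W = k ∧ ∀ w ∈ W, ∀ x ∈ N, ∀ y ∈ N, ⟪w, x - y⟫ ≤ k * η * ‖w‖ := by
    intro k
    induction k with
    | zero =>
      intro _
      refine ⟨K, subset_rfl, hK, ⊥, by simp, ?_⟩
      intro w hw x _ y _
      rw [Submodule.mem_bot] at hw
      simp [hw]
    | succ k ih =>
      intro hk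
      obtain ⟨N, hNK, hN, W, hW, hthin⟩ := ih (by omega)
      have hWo : Module.finrank ℝ Wᗮ = m + 1 - k := by
        have := Submodule.finrank_add_finrank_orthogonal W
        omega
      set B := stdOrthonormalBasis ℝ Wᗮ with hB
      set e₁ : E := ((B ⟨0, by omega⟩ : Wᗮ) : E) with he₁
      set e₂ : E := ((B ⟨1, by omega⟩ : Wᗮ) : E) with he₂
      have n₁ : ‖e₁‖ = 1 := B.orthonormal.1 _
      have n₂ : ‖e₂‖ = 1 := B.orthonormal.1 _
      have n₁₂ : ⟪e₁, e₂⟫ = 0 := B.orthonormal.2 (by simp)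
      obtain ⟨N', hN'N, hN', c, s, hcs, hw⟩ := hN.exists_thin_in_plane h₁ h₂ h₃ n₁ n₂ n₁₂ hη0
      set v : E := c • e₁ + s • e₂ with hv
      have hvW : v ∈ Wᗮ := Wᗮ.add_mem (Wᗮ.smul_mem _ (B _).2) (Wᗮ.smul_mem _ (B _).2)
      have hvv : ⟪v, v⟫ = 1 := by
        simp only [hv, inner_add_left, inner_add_right, inner_smul_left, inner_smul_right, n₁₂,
          real_inner_comm e₁ e₂, real_inner_self_eq_norm_sq, n₁, n₂, conj_trivial]
        linear_combination hcs
      have hv0 : v ≠ 0 := by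
        intro h; rw [h] at hvv; simp at hvv
      refine ⟨N', hN'N.trans hNK, hN', W ⊔ ℝ ∙ v, ?_, ?_⟩
      · have h := Submodule.finrank_sup_add_finrank_inf_eq W (ℝ ∙ v)
        have hinf : W ⊓ (ℝ ∙ v) = ⊥ := by
          rw [eq_bot_iff, ← Submodule.inf_orthogonal_eq_bot W]
          exact inf_le_inf_left _ ((Submodule.span_singleton_le_iff_mem _ _).2 hvW)
        rw [hinf, finrank_bot, finrank_span_singleton hv0, hW] at h
        omega
      · intro w' hw' x hx y hy
        obtain ⟨w, hwW, z, hz, rfl⟩ := Submodule.mem_sup.1 hw'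
        obtain ⟨r, rfl⟩ := Submodule.mem_span_singleton.1 hz
        have hwv : ⟪w, v⟫ = 0 := hvW w hwW
        have hnorm : ‖w + r • v‖ ^ 2 = ‖w‖ ^ 2 + r ^ 2 := by
          rw [← real_inner_self_eq_norm_sq, ← real_inner_self_eq_norm_sq]
          simp only [inner_add_left, inner_add_right, inner_smul_left, inner_smul_right,
            real_inner_comm w v, hwv, hvv, conj_trivial]
          ring
        have b1 : ‖w‖ ≤ ‖w + r • v‖ := abs_le_of_sq_le_sq' (by nlinarith) (norm_nonneg _) |>.2
        have b2 : |r| ≤ ‖w + r • v‖ := abs_le_of_sq_le_sq (by nlinarith) (norm_nonneg _)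
        have t1 := hthin w hwW x (hN'N hx) y (hN'N hy)
        have t2 : r * ⟪v, x - y⟫ ≤ |r| * η := by
          have hab : |⟪v, x - y⟫| ≤ η := by
            rw [abs_le]
            have := hw y hy x hx
            rw [← neg_sub x y, inner_neg_right] at this
            exact ⟨by linarith, hw x hx y hy⟩
          calc r * ⟪v, x - y⟫ ≤ |r * ⟪v, x - y⟫| := le_abs_self _
            _ = |r| * |⟪v, x - y⟫| := abs_mul _ _
            _ ≤ |r| * η := by gcongr
        rw [inner_add_left, inner_smul_left, conj_trivial]
        push_cast
        have kη : 0 ≤ (k : ℝ) * η := by positivity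
        nlinarith [mul_le_mul_of_nonneg_left b1 kη, mul_le_mul_of_nonneg_right b2 hη0.le]
  obtain ⟨N, hNK, hN, W, hW, hthin⟩ := key m le_rfl
  have hWo : Module.finrank ℝ Wᗮ = 1 := by
    have := Submodule.finrank_add_finrank_orthogonal W
    omega
  set B := stdOrthonormalBasis ℝ Wᗮ with hB
  set u : Wᗮ := B ⟨0, by omega⟩ with hu
  have nu : ‖u‖ = 1 := B.orthonormal.1 _
  refine ⟨N, hNK, hN, u, nu, ?_⟩
  intro x hx y hy hxy
  have hmem : x - y ∈ W := by
    rw [← Submodule.orthogonal_orthogonal W]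
    intro w hw
    obtain ⟨c, hc⟩ := (finrank_eq_one_iff_of_nonzero' u (by
      intro h; rw [h] at nu; simp at nu)).1 hWo ⟨w, hw⟩
    have : w = c • (u : E) := by
      have := congrArg Subtype.val hc
      simpa using this.symm
    rw [this, inner_smul_left, inner_sub_right, hxy, sub_self, mul_zero]
  have h := hthin _ hmem x hx y hy
  rw [real_inner_self_eq_norm_sq] at h
  have hmε : m * η ≤ ε := by
    rw [hη, mul_div_assoc', div_le_iff₀ (by positivity)]
    nlinarith
  rcases (norm_nonneg (x - y)).eq_or_lt with h0 | h0
  · rw [← h0]; exact hε.le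
  · nlinarith

end Localization

/-! ### From pointwise to integrated isoperimetry on the line -/

section Line

open MeasureTheory Set Filter Topology

lemma exists_median (ν : Measure ℝ) [IsFiniteMeasure ν] [NullSingletonClass ν] :
    ∃ M : ℝ, (∀ x, M < x → ν (Ioi x) ≤ ν (Iio x)) ∧ ∀ x, x < M → ν (Iio x) ≤ ν (Ioi x) := by
  rcases eq_or_ne (ν univ) 0 with h0 | h0
  · rw [Measure.measure_univ_eq_zero] at h0
    exact ⟨0, by simp [h0]⟩
  have hhalf : ν univ / 2 < ν univ := ENNReal.half_lt_self h0 (measure_ne_top _ _)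
  have hsum : ∀ x, ν (Iic x) + ν (Ioi x) = ν univ := fun x => by
    rw [← compl_Iic, measure_add_measure_compl measurableSet_Iic]
  have hIic : ∀ x, ν (Iio x) = ν (Iic x) := fun x => measure_congr Iio_ae_eq_Iic
  have hnot : ∀ x, ν univ / 2 < ν (Iic x) → ν univ / 2 < ν (Ioi x) → False := by
    intro x h1 h2
    have := ENNReal.add_lt_add h1 h2
    rw [hsum, ENNReal.add_halves] at this
    exact lt_irrefl _ this
  set A : Set ℝ := {x | ν (Iic x) ≤ ν (Ioi x)} with hA
  have hAne : A.Nonempty := by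
    obtain ⟨x, hx⟩ := ((tendsto_measure_Ici_atBot ν).eventually_const_lt hhalf).exists
    refine ⟨x, ?_⟩
    by_contra hcon
    have hcon : ν (Ioi x) < ν (Iic x) := not_le.1 hcon
    rw [← measure_congr Ioi_ae_eq_Ici] at hx
    exact hnot x (hx.trans hcon) hx
  have hAbdd : BddAbove A := by
    obtain ⟨x, hx⟩ := ((tendsto_measure_Iic_atTop ν).eventually_const_lt hhalf).exists
    refine ⟨x, fun y hy => ?_⟩
    by_contra! hcon
    have h1 : ν univ / 2 < ν (Iic y) := hx.trans_le (measure_mono (Iic_subset_Iic.2 hcon.le))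
    exact hnot y h1 (h1.trans_le hy)
  refine ⟨sSup A, fun x hx => ?_, fun x hx => ?_⟩
  · by_contra! hcon
    rw [hIic] at hcon
    exact not_lt.2 (le_csSup hAbdd hcon.le) hx
  · obtain ⟨y, hy, hxy⟩ := exists_lt_of_lt_csSup hAne hx
    rw [hIic]
    exact (measure_mono (Iic_subset_Iic.2 hxy.le)).trans
      (le_trans hy (measure_mono (Ioi_subset_Ioi hxy.le)))

/-- If `T₁` is at `σ`-distance at least `d / 2` from `M` and at least `d` from `T₂`, then between
`M` and any point of `T₁` there is a gap of `σ`-length at least `d / 2` that avoids both sets. -/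
lemma half_le_lintegral_gap {σ : ℝ → ℝ≥0∞} {T₁ T₂ : Set ℝ} (h₁ : IsClosed T₁) (h₂ : IsClosed T₂)
    {d : ℝ≥0∞} (hd : ∀ s ∈ T₁, ∀ t ∈ T₂, d ≤ ∫⁻ x in uIoc s t, σ x) {M : ℝ}
    (hM : ∀ s ∈ T₁, d / 2 ≤ ∫⁻ x in uIoc s M, σ x) {t : ℝ} (ht : t ∈ T₁) :
    d / 2 ≤ ∫⁻ x in uIoc M t ∩ (T₁ ∪ T₂)ᶜ, σ x := by
  -- the point of `T₂ ∪ {M}` between `M` and `t` that is closest to `t`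
  obtain ⟨b, ⟨hb, hbI⟩, hbmin⟩ :=
    (isCompact_uIcc.inter_left (h₂.union (isClosed_singleton (x := M)))
    : IsCompact ((T₂ ∪ {M}) ∩ uIcc M t)).exists_isMinOn (f := fun x => |x - t|)
    ⟨M, by simp⟩ (by fun_prop)
  -- the point of `T₁` between `b` and `t` that is closest to `b`
  obtain ⟨s, ⟨hs, hsI⟩, hsmin⟩ := (isCompact_uIcc.inter_left h₁
    : IsCompact (T₁ ∩ uIcc b t)).exists_isMinOn (f := fun x => |x - b|)
    ⟨t, ht, by simp⟩ (by fun_prop)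
  have hlong : d / 2 ≤ ∫⁻ x in uIoc s b, σ x := by
    rcases hb with hb | hb
    · exact ENNReal.half_le_self.trans (hd s hs b hb)
    · rw [mem_singleton_iff] at hb
      rw [hb]; exact hM s hs
  refine hlong.trans ?_
  have hae : (uIoc s b \ {s, b} : Set ℝ) =ᵐ[volume] (uIoc s b : Set ℝ) := by
    refine sdiff_null_ae_eq_self ?_
    exact (Set.Finite.insert s (Set.finite_singleton b)).measure_zero _
  rw [← setLIntegral_congr hae]
  refine lintegral_mono_set ?_
  rintro x ⟨hx, hxe⟩
  simp only [mem_insert_iff, mem_singleton_iff, not_or] at hxe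
  rw [isMinOn_iff] at hbmin hsmin
  rw [mem_uIoc] at hx
  have hxs := fun h => hsmin x ⟨h, ?_⟩
  have hxb := fun h => hbmin x ⟨Or.inl h, ?_⟩
  rotate_left
  · rw [mem_uIcc] at hbI hsI ⊢
    rcases hbI with hbI | hbI <;> rcases hsI with hsI | hsI <;> rcases hx with hx | hx <;>
      first
        | exact Or.inl ⟨by linarith, by linarith⟩
        | exact Or.inr ⟨by linarith, by linarith⟩
  · rw [mem_uIcc] at hbI hsI ⊢
    rcases hbI with hbI | hbI <;> rcases hsI with hsI | hsI <;> rcases hx with hx | hx <;>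
      first
        | exact Or.inl ⟨by linarith, by linarith⟩
        | exact Or.inr ⟨by linarith, by linarith⟩
  rw [mem_uIcc] at hbI hsI
  refine ⟨?_, ?_⟩
  · rw [mem_uIoc]
    rcases hbI with hbI | hbI <;> rcases hsI with hsI | hsI <;> rcases hx with hx | hx <;>
      first
        | exact Or.inl ⟨by linarith, by linarith⟩
        | exact Or.inr ⟨by linarith, by linarith⟩
  · rintro (h | h)
    · have := hxs h
      rcases hx with hx | hx
      · have hne : x < b := lt_of_le_of_ne hx.2 hxe.2
        rw [abs_of_nonpos (by linarith), abs_of_neg (by linarith)] at this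
        linarith
      · have hne : x < s := lt_of_le_of_ne hx.2 hxe.1
        rw [abs_of_nonneg (by linarith), abs_of_pos (by linarith)] at this
        linarith
    · have := hxb h
      rcases hsI with hsI | hsI
      · have hx' : b < x ∧ x ≤ s := by
          rcases hx with hx | hx
          · exact absurd (by linarith [hx.1, hx.2]) hxe.2
          · exact hx
        rw [abs_of_nonpos (by linarith), abs_of_nonpos (by linarith)] at this
        linarith
      · have hx' : s < x ∧ x ≤ b := by
          rcases hx with hx | hx
          · exact hx
          · exact absurd (by linarith [hx.1, hx.2]) hxe.1
        have hne : x < b := lt_of_le_of_ne hx'.2 hxe.2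
        rw [abs_of_nonneg (by linarith), abs_of_nonneg (by linarith)] at this
        linarith

/-- A density that dominates, at each point, the weight `σ` times the smaller of the two tails
satisfies an isoperimetric inequality for the distance induced by `σ`. -/
theorem isoperimetry_of_pointwise {ρ σ : ℝ → ℝ≥0∞} (hρ : Measurable ρ) (hσ : Measurable σ)
    (hfin : ∫⁻ x, ρ x ≠ ∞) {C : ℝ≥0∞}
    (hpt : ∀ s, σ s * min (∫⁻ t in Iio s, ρ t) (∫⁻ t in Ioi s, ρ t) ≤ C * ρ s)
    {T₁ T₂ : Set ℝ} (h₁ : IsClosed T₁) (h₂ : IsClosed T₂) {d : ℝ≥0∞}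
    (hd : ∀ s ∈ T₁, ∀ t ∈ T₂, d ≤ ∫⁻ x in uIoc s t, σ x) :
    d / 2 * min (∫⁻ t in T₁, ρ t) (∫⁻ t in T₂, ρ t) ≤ C * ∫⁻ t in (T₁ ∪ T₂)ᶜ, ρ t := by
  set ν := volume.withDensity ρ with hν
  have : IsFiniteMeasure ν := isFiniteMeasure_withDensity hfin
  have : NullSingletonClass ν := by infer_instance
  have hνs : ∀ S : Set ℝ, ∫⁻ t in S, ρ t = ν S := fun S => (withDensity_apply' ρ S).symm
  simp only [hνs] at hpt ⊢
  obtain ⟨M, hM1, hM2⟩ := exists_median ν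
  have far : ∀ T₁ T₂ : Set ℝ, IsClosed T₁ → IsClosed T₂ →
      (∀ s ∈ T₁, ∀ t ∈ T₂, d ≤ ∫⁻ x in uIoc s t, σ x) →
      (∀ s ∈ T₁, d / 2 ≤ ∫⁻ x in uIoc s M, σ x) → d / 2 * ν T₁ ≤ C * ν (T₁ ∪ T₂)ᶜ := by
    intro T₁ T₂ h₁ h₂ hd hfar
    have hU : MeasurableSet (T₁ ∪ T₂)ᶜ := (h₁.union h₂).measurableSet.compl
    have hmeas : MeasurableSet {p : ℝ × ℝ | p.2 ∈ uIoc M p.1} := by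
      have : {p : ℝ × ℝ | p.2 ∈ uIoc M p.1} = {p | min M p.1 < p.2} ∩ {p | p.2 ≤ max M p.1} := by
        ext p; simp [uIoc]
      rw [this]
      exact (measurableSet_lt (by fun_prop) (by fun_prop)).inter
        (measurableSet_le (by fun_prop) (by fun_prop))
    set G : ℝ → ℝ → ℝ≥0∞ := fun t => (uIoc M t).indicator σ with hG
    have hGm : Measurable (Function.uncurry G) :=
      (hσ.comp measurable_snd).indicator hmeas
    calc d / 2 * ν T₁ = ∫⁻ t in T₁, d / 2 ∂ν := by rw [setLIntegral_const]
      _ ≤ ∫⁻ t in T₁, (∫⁻ x in (T₁ ∪ T₂)ᶜ, G t x) ∂ν := by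
          refine lintegral_mono_ae ((ae_restrict_iff' h₁.measurableSet).2
            (.of_forall fun t ht => ?_))
          refine (half_le_lintegral_gap h₁ h₂ hd hfar ht).trans (le_of_eq ?_)
          rw [← Measure.restrict_restrict measurableSet_uIoc,
            ← lintegral_indicator measurableSet_uIoc]
      _ ≤ ∫⁻ t, (∫⁻ x in (T₁ ∪ T₂)ᶜ, G t x) ∂ν :=
          setLIntegral_le_lintegral _ _
      _ = ∫⁻ x in (T₁ ∪ T₂)ᶜ, (∫⁻ t, G t x ∂ν) :=
          lintegral_lintegral_swap hGm.aemeasurable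
      _ ≤ ∫⁻ x in (T₁ ∪ T₂)ᶜ, C * ρ x := by
          refine setLIntegral_mono_ae' hU ?_
          have hne : ∀ᵐ x : ℝ, x ≠ M := by simp [ae_iff]
          filter_upwards [hne] with x hx _
          refine le_trans ?_ (hpt x)
          have e : ∀ t, G t x = {t | x ∈ uIoc M t}.indicator (fun _ => σ x) t := fun t => rfl
          have hS : MeasurableSet {t | x ∈ uIoc M t} :=
            hmeas.preimage (measurable_id.prodMk (measurable_const (a := x)))
          simp only [e]
          rw [lintegral_indicator_const hS]
          refine mul_le_mul_right ?_ _
          rcases lt_or_gt_of_ne hx with h | h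
          · have : {t | x ∈ uIoc M t} ⊆ Iio x := by
              intro t ht
              simp only [mem_ofPred_eq, mem_uIoc] at ht
              rcases ht with ht | ht
              · exact absurd ht.1 (by linarith)
              · exact ht.1
            exact (measure_mono this).trans (le_min le_rfl (hM2 x h))
          · have : {t | x ∈ uIoc M t} ⊆ Ici x := by
              intro t ht
              simp only [mem_ofPred_eq, mem_uIoc] at ht
              rcases ht with ht | ht
              · exact ht.2
              · exact absurd ht.2 (by linarith)
            refine (measure_mono this).trans ?_
            rw [← measure_congr Ioi_ae_eq_Ici]
            exact le_min (hM1 x h) le_rfl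
      _ = C * ν (T₁ ∪ T₂)ᶜ := by
          rw [lintegral_const_mul _ hρ, hνs]
  by_cases hcase : ∀ s ∈ T₁, d / 2 ≤ ∫⁻ x in uIoc s M, σ x
  · exact (mul_le_mul_right (min_le_left _ _) _).trans (far T₁ T₂ h₁ h₂ hd hcase)
  · have hd' : ∀ s ∈ T₂, ∀ t ∈ T₁, d ≤ ∫⁻ x in uIoc s t, σ x := fun s hs t ht => by
      rw [uIoc_comm]; exact hd t ht s hs
    have := far T₂ T₁ h₂ h₁ hd' (by
      push Not at hcase
      obtain ⟨s, hs, hsM⟩ := hcase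
      intro t ht
      by_contra! hcon
      have hsub : uIoc s t ⊆ uIoc s M ∪ uIoc t M := by
        intro x hx
        simp only [mem_union, mem_uIoc] at hx ⊢
        rcases le_or_gt x M with h | h <;> rcases hx with hx | hx
        · exact Or.inl (Or.inl ⟨hx.1, h⟩)
        · exact Or.inr (Or.inl ⟨hx.1, h⟩)
        · exact Or.inr (Or.inr ⟨h, hx.2⟩)
        · exact Or.inl (Or.inr ⟨h, hx.2⟩)
      have h1 := (hd s hs t ht).trans ((lintegral_mono_set hsub).trans (lintegral_union_le _ _ _))
      have h2 := ENNReal.add_lt_add hsM hcon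
      rw [ENNReal.add_halves] at h2
      exact not_le.2 h2 h1)
    rw [union_comm]
    exact (mul_le_mul_right (min_le_right _ _) _).trans this

end Line

/-! ### The pointwise estimate for a log-concave weight -/

section Pointwise

open MeasureTheory Set Filter Topology

/-- If a density is dominated by an exponential on the left of `s` and by a Gaussian with the same
linear part on the right, then one of the tails is small compared with its value at `s`: the left
one if the exponential decays at rate at least `k`, the right one otherwise. -/
lemma mul_min_tails_le_of_gaussian_right {ρ : ℝ → ℝ≥0∞} {s q k : ℝ} (hk : 0 < k)
    (hl : ∀ t, t < s → ρ t ≤ ρ s * ENNReal.ofReal (Real.exp (q * (t - s))))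
    (hr : ∀ t, s < t →
      ρ t ≤ ρ s * ENNReal.ofReal (Real.exp (q * (t - s) + -(k ^ 2 / 2) * (t - s) ^ 2))) :
    ENNReal.ofReal k * min (∫⁻ t in Iio s, ρ t) (∫⁻ t in Ioi s, ρ t)
      ≤ ENNReal.ofReal (Real.exp 2) * ρ s := by
  have hkk : ∀ {b : ℝ}, ENNReal.ofReal k * (ρ s * ENNReal.ofReal (b / k))
      = ENNReal.ofReal b * ρ s := by
    intro b
    rw [mul_left_comm, ← ENNReal.ofReal_mul hk.le, mul_div_cancel₀ _ hk.ne', mul_comm]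
  rcases le_or_gt k q with hq | hq
  · have h1 : ∫⁻ t in Iio s, ρ t ≤ ρ s * ENNReal.ofReal (1 / k) := by
      calc ∫⁻ t in Iio s, ρ t
          ≤ ∫⁻ t in Iio s, ρ s * ENNReal.ofReal (Real.exp (k * t) * Real.exp (-(k * s))) := by
            refine setLIntegral_mono' measurableSet_Iio fun t ht => (hl t ht).trans ?_
            have ht : t < s := ht
            rw [← Real.exp_add]
            gcongr
            nlinarith
        _ ≤ ∫⁻ t in Iic s, ρ s * ENNReal.ofReal (Real.exp (k * t) * Real.exp (-(k * s))) :=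
            lintegral_mono_set Iio_subset_Iic_self
        _ = ρ s * ENNReal.ofReal (1 / k) := by
            rw [lintegral_const_mul _ (by fun_prop), ← ofReal_integral_eq_lintegral_ofReal
              ((integrableOn_exp_mul_Iic hk s).mul_const _) (.of_forall fun t => by positivity),
              integral_mul_const, integral_exp_mul_Iic hk, div_mul_eq_mul_div, ← Real.exp_add]
            simp
    calc _ ≤ ENNReal.ofReal k * (ρ s * ENNReal.ofReal (1 / k)) := by
          gcongr; exact (min_le_left _ _).trans h1
      _ ≤ _ := by
          rw [hkk]
          gcongr
          exact Real.one_le_exp (by norm_num)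
  · have h1 : ∫⁻ t in Ioi s, ρ t ≤ ρ s * ENNReal.ofReal (Real.exp 2 / k) := by
      calc ∫⁻ t in Ioi s, ρ t
          ≤ ∫⁻ t in Ioi s, ρ s * ENNReal.ofReal (Real.exp (-k * t) * Real.exp (2 + k * s)) := by
            refine setLIntegral_mono' measurableSet_Ioi fun t ht => (hr t ht).trans ?_
            have ht : s < t := ht
            rw [← Real.exp_add]
            refine mul_le_mul_right (ENNReal.ofReal_le_ofReal (Real.exp_le_exp.2 ?_)) _
            nlinarith [mul_pos (sub_pos.2 ht) (sub_pos.2 hq), sq_nonneg (k * (t - s) - 2)]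
        _ = ρ s * ENNReal.ofReal (Real.exp 2 / k) := by
            rw [lintegral_const_mul _ (by fun_prop), ← ofReal_integral_eq_lintegral_ofReal
              ((integrableOn_exp_mul_Ioi (neg_lt_zero.2 hk) s).mul_const _)
              (.of_forall fun t => by positivity),
              integral_mul_const, integral_exp_mul_Ioi (neg_lt_zero.2 hk), neg_div_neg_eq,
              div_mul_eq_mul_div, ← Real.exp_add]
            congr 4; ring
    calc _ ≤ ENNReal.ofReal k * (ρ s * ENNReal.ofReal (Real.exp 2 / k)) := by
          gcongr; exact (min_le_right _ _).trans h1
      _ = _ := hkk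

lemma setLIntegral_comp_neg (f : ℝ → ℝ≥0∞) (s : Set ℝ) :
    ∫⁻ t in -s, f (-t) = ∫⁻ t in s, f t :=
  (Measure.measurePreserving_neg volume).setLIntegral_comp_preimage_emb
    (Homeomorph.neg ℝ).measurableEmbedding f s

lemma mul_min_tails_le_of_gaussian_left {ρ : ℝ → ℝ≥0∞} {s q k : ℝ} (hk : 0 < k)
    (hl : ∀ t, t < s →
      ρ t ≤ ρ s * ENNReal.ofReal (Real.exp (q * (t - s) + -(k ^ 2 / 2) * (t - s) ^ 2)))
    (hr : ∀ t, s < t → ρ t ≤ ρ s * ENNReal.ofReal (Real.exp (q * (t - s)))) :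
    ENNReal.ofReal k * min (∫⁻ t in Iio s, ρ t) (∫⁻ t in Ioi s, ρ t)
      ≤ ENNReal.ofReal (Real.exp 2) * ρ s := by
  have := mul_min_tails_le_of_gaussian_right (ρ := fun t => ρ (-t)) (s := -s) (q := -q) hk
    (fun t ht => by
      have := hr (-t) (by linarith)
      simp only [neg_neg]
      convert this using 4; ring)
    (fun t ht => by
      have := hl (-t) (by linarith)
      simp only [neg_neg]
      convert this using 4; ring)
  have e1 : ∫⁻ t in Iio (-s), ρ (-t) = ∫⁻ t in Ioi s, ρ t := by
    rw [← setLIntegral_comp_neg]; simp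
  have e2 : ∫⁻ t in Ioi (-s), ρ (-t) = ∫⁻ t in Iio s, ρ t := by
    rw [← setLIntegral_comp_neg]; simp
  rw [e1, e2, min_comm, neg_neg] at this
  exact this

/-- Supporting line of a convex function at a differentiability point, possibly an endpoint. -/
lemma tangent_le_of_convexOn {D : Set ℝ} {f : ℝ → ℝ} {s m x : ℝ} (hf : ConvexOn ℝ D f) (hs : s ∈ D)
    (hx : x ∈ D) (hd : HasDerivAt f m s) : f s + m * (x - s) ≤ f x := by
  rcases lt_trichotomy s x with h | rfl | h
  · have := hf.le_slope_of_hasDerivAt hs hx h hd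
    rw [slope_def_field, le_div_iff₀ (by linarith)] at this
    linarith
  · simp
  · have := hf.slope_le_of_hasDerivAt hx hs h hd
    rw [slope_def_field, div_le_iff₀ (by linarith)] at this
    linarith

/-- Log-concavity of an extended-nonnegative function on a set. -/
def LogConcaveOn (D : Set ℝ) (A : ℝ → ℝ≥0∞) : Prop :=
  ∀ x ∈ D, ∀ y ∈ D, ∀ s t : ℝ, 0 < s → 0 < t → s + t = 1 → A x ^ s * A y ^ t ≤ A (s * x + t * y)

/-- A log-concave function lies below an exponential that touches it at a given interior point of
its support. -/
lemma LogConcaveOn.exists_exp_bound {D : Set ℝ} {A : ℝ → ℝ≥0∞} (hA : LogConcaveOn D A)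
    (hD : Convex ℝ D) (hfin : ∀ x, A x ≠ ∞) {r s t : ℝ} (hr : r ∈ D) (ht : t ∈ D) (hrs : r < s)
    (hst : s < t) (hr0 : A r ≠ 0) (ht0 : A t ≠ 0) :
    ∃ p : ℝ, ∀ x ∈ D, A x ≤ A s * ENNReal.ofReal (Real.exp (p * (x - s))) := by
  set J := {x ∈ D | A x ≠ 0} with hJ
  set B : ℝ → ℝ := fun x => -Real.log (A x).toReal with hB
  have hpos : ∀ x ∈ J, 0 < (A x).toReal := fun x hx => ENNReal.toReal_pos hx.2 (hfin x)
  have hmemJ : ∀ x ∈ J, ∀ y ∈ J, ∀ a b : ℝ, 0 < a → 0 < b → a + b = 1 → a * x + b * y ∈ J := by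
    intro x hx y hy a b ha hb hab
    refine ⟨hD hx.1 hy.1 ha.le hb.le hab, fun h0 => ?_⟩
    have := hA x hx.1 y hy.1 a b ha hb hab
    rw [h0, nonpos_iff_eq_zero, mul_eq_zero] at this
    rcases this with h | h
    · exact hx.2 ((ENNReal.rpow_eq_zero_iff_of_pos ha).1 h)
    · exact hy.2 ((ENNReal.rpow_eq_zero_iff_of_pos hb).1 h)
  have hJc : Convex ℝ J := convex_iff_forall_pos.2 fun x hx y hy a b ha hb hab =>
    hmemJ x hx y hy a b ha hb hab
  have hBc : ConvexOn ℝ J B := by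
    refine convexOn_iff_forall_pos.2 ⟨hJc, fun x hx y hy a b ha hb hab => ?_⟩
    have h := ENNReal.toReal_mono (hfin _) (hA x hx.1 y hy.1 a b ha hb hab)
    rw [ENNReal.toReal_mul, ← ENNReal.toReal_rpow, ← ENNReal.toReal_rpow] at h
    have px := hpos x hx
    have py := hpos y hy
    have h2 := Real.log_le_log (by positivity) h
    rw [Real.log_mul (by positivity) (by positivity), Real.log_rpow px, Real.log_rpow py] at h2
    simp only [hB, smul_eq_mul]
    linarith
  have hrt : Ioo r t ⊆ J := by
    intro x hx
    have : x ∈ segment ℝ r t := by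
      rw [segment_eq_Icc (by linarith)]; exact Ioo_subset_Icc_self hx
    exact hJc.segment_subset ⟨hr, hr0⟩ ⟨ht, ht0⟩ this
  have hsI : s ∈ interior J := mem_interior.2 ⟨_, hrt, isOpen_Ioo, hrs, hst⟩
  have hsJ := interior_subset hsI
  refine ⟨-derivWithin B (Ioi s) s, fun x hx => ?_⟩
  by_cases hx0 : A x = 0
  · rw [hx0]; exact zero_le
  have hxJ : x ∈ J := ⟨hx, hx0⟩
  have key : B s + derivWithin B (Ioi s) s * (x - s) ≤ B x := by
    rcases lt_trichotomy s x with h | rfl | h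
    · have := hBc.rightDeriv_le_slope_of_mem_interior hsI hxJ h
      rw [slope_def_field, le_div_iff₀ (by linarith)] at this
      linarith
    · simp
    · have := (hBc.slope_le_leftDeriv_of_mem_interior hxJ hsI h).trans
        (hBc.leftDeriv_le_rightDeriv_of_mem_interior hsI)
      rw [slope_def_field, div_le_iff₀ (by linarith)] at this
      linarith
  have ps := hpos s hsJ
  have px := hpos x hxJ
  have h2 : (A x).toReal ≤ (A s).toReal * Real.exp (-derivWithin B (Ioi s) s * (x - s)) := by
    rw [← Real.log_le_log_iff px (by positivity), Real.log_mul (by positivity) (by positivity),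
      Real.log_exp]
    simp only [hB] at key ⊢
    linarith
  have h3 := ENNReal.ofReal_le_ofReal h2
  rwa [ENNReal.ofReal_mul ps.le, ENNReal.ofReal_toReal (hfin x), ENNReal.ofReal_toReal (hfin s)]
    at h3

/-- A convex function is at least its value at `s` on one of the two sides of `s`. -/
lemma le_right_or_le_left_of_convexOn {D : Set ℝ} {f : ℝ → ℝ} (hf : ConvexOn ℝ D f) {s : ℝ} :
    (∀ x ∈ D, s ≤ x → f s ≤ f x) ∨ (∀ x ∈ D, x ≤ s → f s ≤ f x) := by
  by_contra! hcon
  obtain ⟨⟨x, hx, hsx, hfx⟩, ⟨y, hy, hys, hfy⟩⟩ := hcon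
  have hs : s ∈ segment ℝ y x := by rw [segment_eq_Icc (by linarith)]; exact ⟨hys, hsx⟩
  have := hf.le_on_segment hy hx hs
  exact absurd this (not_le.2 (max_lt hfy hfx))

/-- The one-dimensional heart of the argument: for `Φ` convex with `Φ''` convex and `A` log-concave,
the density `e^{-Φ} A` on `[a, b]` dominates `√Φ''` times the smaller of its two tails. By convexity
of `Φ''`, on one side of `s` the density is dominated by a Gaussian of curvature `Φ''(s)`. -/
theorem sqrt_mul_min_tails_le {a b : ℝ} {Φ Φ' Φ'' : ℝ → ℝ} {A : ℝ → ℝ≥0∞}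
    (hΦ : ConvexOn ℝ (Icc a b) Φ) (hΦ' : ∀ x ∈ Icc a b, HasDerivAt Φ (Φ' x) x)
    (hΦ'' : ∀ x ∈ Icc a b, HasDerivAt Φ' (Φ'' x) x) (hconv : ConvexOn ℝ (Icc a b) Φ'')
    (hA : LogConcaveOn (Icc a b) A) (hfin : ∀ x, A x ≠ ∞) (s : ℝ) :
    (Icc a b).indicator (fun t => ENNReal.ofReal √(Φ'' t)) s *
        min (∫⁻ t in Iio s, (Icc a b).indicator (fun t => ENNReal.ofReal (Real.exp (-Φ t)) * A t) t)
          (∫⁻ t in Ioi s, (Icc a b).indicator (fun t => ENNReal.ofReal (Real.exp (-Φ t)) * A t) t)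
      ≤ ENNReal.ofReal (Real.exp 2) *
        (Icc a b).indicator (fun t => ENNReal.ofReal (Real.exp (-Φ t)) * A t) s := by
  set ρ := (Icc a b).indicator (fun t => ENNReal.ofReal (Real.exp (-Φ t)) * A t) with hρ
  by_cases hs : s ∈ Icc a b
  swap
  · simp [hs]
  rw [indicator_of_mem hs]
  rcases le_or_gt (Φ'' s) 0 with hκ | hκ
  · simp [Real.sqrt_eq_zero_of_nonpos hκ]
  by_cases hleft : ∀ t ∈ Iio s, ρ t = 0
  · rw [setLIntegral_congr_fun measurableSet_Iio hleft]; simp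
  by_cases hright : ∀ t ∈ Ioi s, ρ t = 0
  · rw [setLIntegral_congr_fun measurableSet_Ioi hright]; simp
  push Not at hleft hright
  obtain ⟨r, hrs, hr⟩ := hleft
  obtain ⟨t, hst, ht⟩ := hright
  have hmem : ∀ {x}, ρ x ≠ 0 → x ∈ Icc a b ∧ A x ≠ 0 := by
    intro x hx
    have h1 : x ∈ Icc a b := mem_of_indicator_ne_zero hx
    refine ⟨h1, fun h0 => hx ?_⟩
    simp [hρ, h0]
  obtain ⟨p, hp⟩ := hA.exists_exp_bound (convex_Icc a b) hfin (hmem hr).1 (hmem ht).1 hrs hst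
    (hmem hr).2 (hmem ht).2
  have hk : 0 < √(Φ'' s) := Real.sqrt_pos.2 hκ
  have hksq : √(Φ'' s) ^ 2 = Φ'' s := Real.sq_sqrt hκ.le
  have bound : ∀ x (e : ℝ), (x ∈ Icc a b → Φ s + Φ' s * (x - s) + e ≤ Φ x) →
      ρ x ≤ ρ s * ENNReal.ofReal (Real.exp ((p - Φ' s) * (x - s) + -e)) := by
    intro x e hx
    by_cases hxD : x ∈ Icc a b
    swap
    · rw [hρ, indicator_of_notMem hxD]; exact zero_le
    rw [hρ, indicator_of_mem hxD, indicator_of_mem hs]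
    calc ENNReal.ofReal (Real.exp (-Φ x)) * A x
        ≤ ENNReal.ofReal (Real.exp (-(Φ s + Φ' s * (x - s) + e))) *
            (A s * ENNReal.ofReal (Real.exp (p * (x - s)))) := by
          gcongr
          · exact hx hxD
          · exact hp x hxD
      _ = (ENNReal.ofReal (Real.exp (-(Φ s + Φ' s * (x - s) + e))) *
            ENNReal.ofReal (Real.exp (p * (x - s)))) * A s := by ring
      _ = (ENNReal.ofReal (Real.exp (-Φ s)) *
            ENNReal.ofReal (Real.exp ((p - Φ' s) * (x - s) + -e))) * A s := by
          rw [← ENNReal.ofReal_mul (Real.exp_nonneg _), ← ENNReal.ofReal_mul (Real.exp_nonneg _),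
            ← Real.exp_add, ← Real.exp_add]
          congr 3; ring
      _ = _ := by ring
  have lin : ∀ x, ρ x ≤ ρ s * ENNReal.ofReal (Real.exp ((p - Φ' s) * (x - s))) := by
    intro x
    have := bound x 0 fun hx => by
      simpa using tangent_le_of_convexOn hΦ hs hx (hΦ' s hs)
    simpa using this
  have quad : ∀ D ⊆ Icc a b, Convex ℝ D → s ∈ D → (∀ x ∈ D, Φ'' s ≤ Φ'' x) → ∀ x ∈ D,
      Φ s + Φ' s * (x - s) + Φ'' s / 2 * (x - s) ^ 2 ≤ Φ x := by
    intro D hD hDc hsD hle x hx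
    have hg : ∀ y ∈ D, HasDerivAt (fun y => Φ y - Φ'' s / 2 * (y - s) ^ 2)
        (Φ' y - Φ'' s * (y - s)) y := by
      intro y hy
      have := (hΦ' y (hD hy)).sub ((((hasDerivAt_id y).sub_const s).pow 2).const_mul (Φ'' s / 2))
      refine HasDerivAt.congr_deriv this ?_
      simp only [id_eq]; ring
    have hg' : ∀ y ∈ D, HasDerivAt (fun y => Φ' y - Φ'' s * (y - s)) (Φ'' y - Φ'' s) y := by
      intro y hy
      have := (hΦ'' y (hD hy)).sub (((hasDerivAt_id y).sub_const s).const_mul (Φ'' s))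
      refine HasDerivAt.congr_deriv this ?_
      ring
    have hgc : ConvexOn ℝ D (fun y => Φ y - Φ'' s / 2 * (y - s) ^ 2) :=
      convexOn_of_hasDerivWithinAt2_nonneg hDc
        (fun y hy => (hg y hy).continuousAt.continuousWithinAt)
        (fun y hy => (hg y (interior_subset hy)).hasDerivWithinAt)
        (fun y hy => (hg' y (interior_subset hy)).hasDerivWithinAt)
        (fun y hy => by linarith [hle y (interior_subset hy)])
    have := tangent_le_of_convexOn hgc hsD hx (hg s hsD)
    simp only [sub_self] at this
    nlinarith
  rcases le_right_or_le_left_of_convexOn hconv (s := s) with hside | hside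
  · refine mul_min_tails_le_of_gaussian_right (q := p - Φ' s) hk (fun x _ => lin x) fun x hx => ?_
    rw [hksq]
    have := bound x (Φ'' s / 2 * (x - s) ^ 2) fun hxD =>
      quad (Icc s b) (Icc_subset_Icc_left hs.1) (convex_Icc _ _) ⟨le_rfl, hs.2⟩
        (fun y hy => hside y ⟨hs.1.trans hy.1, hy.2⟩ hy.1) x ⟨hx.le, hxD.2⟩
    rwa [← neg_mul] at this
  · refine mul_min_tails_le_of_gaussian_left (q := p - Φ' s) hk (fun x hx => ?_) fun x _ => lin x
    rw [hksq]
    have := bound x (Φ'' s / 2 * (x - s) ^ 2) fun hxD =>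
      quad (Icc a s) (Icc_subset_Icc_right hs.2) (convex_Icc _ _) ⟨hs.1, le_rfl⟩
        (fun y hy => hside y ⟨hy.1, hy.2.trans hs.2⟩ hy.2) x ⟨hxD.1, hx.le⟩
    rwa [← neg_mul] at this

end Pointwise

/-! ### Thin needles -/

section Needle

open MeasureTheory Set Filter Topology
open scoped RealInnerProductSpace

/-- Linear measure-preserving coordinates in which `x ↦ ⟪u, x⟫` is the first coordinate. -/
lemma exists_straightening {m : ℕ} {u : EuclideanSpace ℝ (Fin (m + 1))} (hu : ‖u‖ = 1) :
    ∃ e : EuclideanSpace ℝ (Fin (m + 1)) ≃L[ℝ] ℝ × (Fin m → ℝ),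
      MeasurePreserving e volume volume ∧ ∀ x, (e x).1 = ⟪u, x⟫ := by
  obtain ⟨b, hb⟩ := Orthonormal.exists_orthonormalBasis_extension_of_card_eq
    (𝕜 := ℝ) (E := EuclideanSpace ℝ (Fin (m + 1))) (ι := Fin (m + 1)) (by simp)
    (v := fun _ => u) (s := {0}) ⟨fun i => hu, fun i j hij => absurd (Subsingleton.elim i j) hij⟩
  have hb0 : b 0 = u := hb 0 rfl
  refine ⟨(b.repr.toContinuousLinearEquiv.trans (EuclideanSpace.equiv (Fin (m + 1)) ℝ)).trans
    (Fin.consEquivL ℝ (fun _ : Fin (m + 1) => ℝ)).symm, ?_, ?_⟩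
  · have h1 := b.measurePreserving_repr
    have h2 := PiLp.volume_preserving_ofLp (Fin (m + 1))
    have h3 := volume_preserving_piFinSuccAbove (fun _ : Fin (m + 1) => ℝ) 0
    exact h3.comp (h2.comp h1)
  · intro x
    rw [← hb0, ← b.repr_apply_apply]
    rfl

/-- The length of `w` at `z` in the Hessian metric of a function on the whole space. -/
noncomputable def hessNorm {E : Type*} [NormedAddCommGroup E] [NormedSpace ℝ E] (ψ : E → ℝ)
    (z w : E) : ℝ :=
  √(iteratedFDeriv ℝ 2 ψ z fun _ => w)

section Calculus

variable {E : Type*} [NormedAddCommGroup E] [NormedSpace ℝ E] {ψ : E → ℝ} {U : Set E}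

lemma hessNorm_nonneg (z w : E) : 0 ≤ hessNorm ψ z w := Real.sqrt_nonneg _

lemma hessNorm_smul (z w : E) (c : ℝ) : hessNorm ψ z (c • w) = |c| * hessNorm ψ z w := by
  have : (iteratedFDeriv ℝ 2 ψ z fun _ => c • w) = c ^ 2 * iteratedFDeriv ℝ 2 ψ z fun _ => w := by
    rw [ContinuousMultilinearMap.map_smul_univ]
    simp [sq]
  rw [hessNorm, this, Real.sqrt_mul (sq_nonneg c), Real.sqrt_sq_eq_abs, hessNorm]

lemma hasDerivAt_iteratedFDeriv_line (hU : IsOpen U) (hψ : ContDiffOn ℝ 4 ψ U) {k : ℕ} (hk : k < 4)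
    {p v : E} {t : ℝ} (ht : p + t • v ∈ U) :
    HasDerivAt (fun t : ℝ => iteratedFDeriv ℝ k ψ (p + t • v) fun _ => v)
      (iteratedFDeriv ℝ (k + 1) ψ (p + t • v) fun _ => v) t := by
  have h1 : DifferentiableAt ℝ (iteratedFDeriv ℝ k ψ) (p + t • v) :=
    (hψ.contDiffAt (hU.mem_nhds ht)).differentiableAt_iteratedFDeriv (by exact_mod_cast hk)
  have h2 : HasDerivAt (fun t : ℝ => p + t • v) v t := by
    simpa using ((hasDerivAt_id t).smul_const v).const_add p
  have h3 := h1.hasFDerivAt.comp_hasDerivAt t h2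
  have h4 := (ContinuousMultilinearMap.apply ℝ (fun _ : Fin k => E) ℝ
    (fun _ => v)).hasFDerivAt.comp_hasDerivAt t h3
  rw [iteratedFDeriv_succ_apply_left]
  exact h4

lemma continuousOn_iteratedFDeriv (hU : IsOpen U) (hψ : ContDiffOn ℝ 4 ψ U) {k : ℕ} (hk : k ≤ 4) :
    ContinuousOn (iteratedFDeriv ℝ k ψ) U :=
  (hψ.continuousOn_iteratedFDerivWithin (by exact_mod_cast hk) hU.uniqueDiffOn).congr
    fun _ hx => (iteratedFDerivWithin_of_isOpen k hU hx).symm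

lemma continuousOn_hessNorm (hU : IsOpen U) (hψ : ContDiffOn ℝ 4 ψ U) :
    ContinuousOn (fun p : E × E => hessNorm ψ p.1 p.2) (U ×ˢ univ) := by
  refine ContinuousOn.sqrt ?_
  refine ContinuousOn.eval ?_ ?_
  · exact (continuousOn_iteratedFDeriv hU hψ (by norm_num)).comp continuousOn_fst fun p hp => hp.1
  · fun_prop

end Calculus

lemma measurable_indicator_of_continuousOn {X : Type*} [TopologicalSpace X] [MeasurableSpace X]
    [OpensMeasurableSpace X] {f : X → ℝ≥0∞} {s : Set X} (hf : ContinuousOn f s)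
    (hs : MeasurableSet s) : Measurable (s.indicator f) := by
  classical
  rw [← piecewise_eq_indicator]
  exact hf.measurable_piecewise continuousOn_const hs

/-- Lower bounds on lengths between two sets on the line pass to their closures. -/
lemma le_lintegral_uIoc_of_closure {f : ℝ → ℝ} (hf : Integrable f) (hf0 : ∀ x, 0 ≤ f x)
    {P Q : Set ℝ} {d : ℝ}
    (h : ∀ s ∈ P, ∀ t ∈ Q, ENNReal.ofReal d ≤ ∫⁻ x in uIoc s t, ENNReal.ofReal (f x))
    {s t : ℝ} (hs : s ∈ closure P) (ht : t ∈ closure Q) :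
    ENNReal.ofReal d ≤ ∫⁻ x in uIoc s t, ENNReal.ofReal (f x) := by
  have hint : ∀ a b, IntervalIntegrable f volume a b := fun a b => hf.intervalIntegrable
  set F : ℝ → ℝ := fun b => ∫ x in (0 : ℝ)..b, f x with hF
  have hFc : Continuous F := intervalIntegral.continuous_primitive hint 0
  have conv : ∀ a b, ∫⁻ x in uIoc a b, ENNReal.ofReal (f x) = ENNReal.ofReal |F b - F a| := by
    intro a b
    rw [← ofReal_integral_eq_lintegral_ofReal hf.integrableOn (.of_forall hf0),
      hF, intervalIntegral.integral_interval_sub_left (hint _ _) (hint _ _),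
      intervalIntegral.abs_integral_eq_abs_integral_uIoc, abs_of_nonneg (integral_nonneg hf0)]
  have hcl : IsClosed {p : ℝ × ℝ | ENNReal.ofReal d ≤ ENNReal.ofReal |F p.2 - F p.1|} :=
    isClosed_le continuous_const (ENNReal.continuous_ofReal.comp (by fun_prop))
  have hsub : P ×ˢ Q ⊆ {p : ℝ × ℝ | ENNReal.ofReal d ≤ ENNReal.ofReal |F p.2 - F p.1|} := by
    rintro ⟨s, t⟩ ⟨hs, ht⟩
    have := h s hs t ht
    rwa [conv] at this
  have := closure_minimal hsub hcl (closure_prod_eq (s := P) (t := Q) ▸ mk_mem_prod hs ht :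
    (s, t) ∈ closure (P ×ˢ Q))
  rw [conv]
  exact this

/-- Sections of a compact convex set have log-concave volume. -/
lemma logConcaveOn_volume_section {m : ℕ} {N : Set (ℝ × (Fin m → ℝ))} (hN : IsCompact N)
    (hNc : Convex ℝ N) (D : Set ℝ) :
    LogConcaveOn D fun t => volume (Prod.mk t ⁻¹' N) := by
  intro x _ y _ s t hs ht hst
  have hm : ∀ r, MeasurableSet (Prod.mk r ⁻¹' N) := fun r =>
    hN.measurableSet.preimage measurable_prodMk_left
  have := satisfiesPrekopaLeindler_pi m
    (f := (Prod.mk x ⁻¹' N).indicator 1) (g := (Prod.mk y ⁻¹' N).indicator 1)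
    (h := (Prod.mk (s * x + t * y) ⁻¹' N).indicator 1)
    (measurable_one.indicator (hm _)) (measurable_one.indicator (hm _))
    (measurable_one.indicator (hm _)) hs ht hst (by
      intro z w
      by_cases hz : z ∈ Prod.mk x ⁻¹' N
      swap
      · simp [indicator_of_notMem hz, hs]
      by_cases hw : w ∈ Prod.mk y ⁻¹' N
      swap
      · simp [indicator_of_notMem hw, ht]
      have : s • z + t • w ∈ Prod.mk (s * x + t * y) ⁻¹' N := hNc hz hw hs.le ht.le hst
      simp [indicator_of_mem hz, indicator_of_mem hw, indicator_of_mem this])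
  simpa only [lintegral_indicator_one (hm _)] using this

lemma volume_section_ne_top {m : ℕ} {N : Set (ℝ × (Fin m → ℝ))} (hN : IsCompact N) (t : ℝ) :
    volume (Prod.mk t ⁻¹' N) ≠ ∞ := by
  refine ne_top_of_le_ne_top (hN.image continuous_snd).measure_lt_top.ne (measure_mono ?_)
  intro y hy
  exact ⟨(t, y), hy, rfl⟩

end Needle

section NeedleEstimate

open MeasureTheory Set Filter Topology
open scoped RealInnerProductSpace

variable {m : ℕ} {u : EuclideanSpace ℝ (Fin (m + 1))}
  {e : EuclideanSpace ℝ (Fin (m + 1)) ≃L[ℝ] ℝ × (Fin m → ℝ)}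
  {N : Set (EuclideanSpace ℝ (Fin (m + 1)))} {w : EuclideanSpace ℝ (Fin (m + 1)) → ℝ≥0∞}

lemma lintegral_eq_lintegral_sections (he : MeasurePreserving e volume volume)
    (hu : ∀ x, (e x).1 = ⟪u, x⟫) (hN : IsCompact N) (hw : ContinuousOn w N) {T : Set ℝ}
    (hT : MeasurableSet T) :
    ∫⁻ x in N ∩ {x | ⟪u, x⟫ ∈ T}, w x
      = ∫⁻ t in T, ∫⁻ y in Prod.mk t ⁻¹' (e '' N), w (e.symm (t, y)) := by
  have hTm : MeasurableSet {x : EuclideanSpace ℝ (Fin (m + 1)) | ⟪u, x⟫ ∈ T} :=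
    hT.preimage (by fun_prop)
  have heN : MeasurableSet (e '' N) := (hN.image e.continuous).measurableSet
  set G := {x : EuclideanSpace ℝ (Fin (m + 1)) | ⟪u, x⟫ ∈ T}.indicator (N.indicator w) with hG
  have hGm : Measurable G :=
    (measurable_indicator_of_continuousOn hw hN.measurableSet).indicator hTm
  have he' : MeasurePreserving e.symm volume volume :=
    MeasurePreserving.symm e.toHomeomorph.toMeasurableEquiv he
  rw [← lintegral_indicator (hN.measurableSet.inter hTm), inter_comm, ← indicator_indicator,
    ← he'.lintegral_comp hGm, Measure.volume_eq_prod,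
    lintegral_prod (fun p => G (e.symm p)) (hGm.comp he'.measurable).aemeasurable,
    ← lintegral_indicator hT]
  refine lintegral_congr fun t => ?_
  by_cases ht : t ∈ T
  · rw [indicator_of_mem ht, ← lintegral_indicator (heN.preimage measurable_prodMk_left)]
    refine lintegral_congr fun y => ?_
    have h1 : e.symm (t, y) ∈ {x | ⟪u, x⟫ ∈ T} := by
      simp only [mem_ofPred_eq, ← hu, e.apply_symm_apply]; exact ht
    rw [hG, indicator_of_mem h1]
    by_cases hy : e.symm (t, y) ∈ N
    · have : y ∈ Prod.mk t ⁻¹' (e '' N) := ⟨_, hy, e.apply_symm_apply _⟩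
      rw [indicator_of_mem hy, indicator_of_mem this]
    · have : y ∉ Prod.mk t ⁻¹' (e '' N) := by
        rintro ⟨x, hx, hxy⟩
        exact hy (by rw [← hxy, e.symm_apply_apply]; exact hx)
      rw [indicator_of_notMem hy, indicator_of_notMem this]
  · rw [indicator_of_notMem ht]
    refine (lintegral_congr fun y => ?_).trans lintegral_zero
    have h1 : e.symm (t, y) ∉ {x | ⟪u, x⟫ ∈ T} := by
      simp only [mem_ofPred_eq, ← hu, e.apply_symm_apply]; exact ht
    rw [hG, indicator_of_notMem h1]

lemma mem_of_mem_section (hu : ∀ x, (e x).1 = ⟪u, x⟫) {t : ℝ} {y : Fin m → ℝ}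
    (hy : y ∈ Prod.mk t ⁻¹' (e '' N)) : e.symm (t, y) ∈ N ∧ ⟪u, e.symm (t, y)⟫ = t := by
  obtain ⟨x, hx, hxy⟩ := hy
  rw [← hxy, e.symm_apply_apply]
  exact ⟨hx, by rw [← hu, hxy]⟩

lemma lintegral_le_mul_lintegral_sections (he : MeasurePreserving e volume volume)
    (hu : ∀ x, (e x).1 = ⟪u, x⟫) (hN : IsCompact N) (hw : ContinuousOn w N) {W : ℝ → ℝ≥0∞}
    {c : ℝ≥0∞} (hc : c ≠ ∞) (h : ∀ x ∈ N, w x ≤ c * W ⟪u, x⟫) {T : Set ℝ} (hT : MeasurableSet T) :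
    ∫⁻ x in N ∩ {x | ⟪u, x⟫ ∈ T}, w x
      ≤ c * ∫⁻ t in T, W t * volume (Prod.mk t ⁻¹' (e '' N)) := by
  rw [lintegral_eq_lintegral_sections he hu hN hw hT, ← lintegral_const_mul' _ _ hc]
  refine lintegral_mono fun t => ?_
  rw [← mul_assoc, ← setLIntegral_const]
  refine setLIntegral_mono' ((hN.image e.continuous).measurableSet.preimage
    measurable_prodMk_left) fun y hy => ?_
  obtain ⟨h1, h2⟩ := mem_of_mem_section hu hy
  have := h _ h1
  rwa [h2] at this

lemma lintegral_sections_le_mul_lintegral (he : MeasurePreserving e volume volume)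
    (hu : ∀ x, (e x).1 = ⟪u, x⟫) (hN : IsCompact N) (hw : ContinuousOn w N) {W : ℝ → ℝ≥0∞}
    {c : ℝ≥0∞} (hc : c ≠ ∞) (h : ∀ x ∈ N, W ⟪u, x⟫ ≤ c * w x) {T : Set ℝ} (hT : MeasurableSet T) :
    ∫⁻ t in T, W t * volume (Prod.mk t ⁻¹' (e '' N))
      ≤ c * ∫⁻ x in N ∩ {x | ⟪u, x⟫ ∈ T}, w x := by
  rw [lintegral_eq_lintegral_sections he hu hN hw hT, ← lintegral_const_mul' _ _ hc]
  refine lintegral_mono fun t => ?_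
  rw [← lintegral_const_mul' _ _ hc, ← setLIntegral_const]
  refine setLIntegral_mono' ((hN.image e.continuous).measurableSet.preimage
    measurable_prodMk_left) fun y hy => ?_
  obtain ⟨h1, h2⟩ := mem_of_mem_section hu hy
  have := h _ h1
  rwa [h2] at this

/-- The isoperimetric inequality on a needle `N` on whose sections orthogonal to `u` both the
function `ψ` and its Hessian metric are almost constant. The needle is compared with the interval
`[a, b]` of values of `⟪u, ·⟫`, weighted by `e^{-ψ}` along an axis of the needle times the volume of
the sections. -/
theorem needle_isoperimetry {U : Set (EuclideanSpace ℝ (Fin (m + 1)))}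
    {ψ : EuclideanSpace ℝ (Fin (m + 1)) → ℝ} (hU : IsOpen U) (hψc : ConvexOn ℝ U ψ)
    (hψ : ContDiffOn ℝ 4 ψ U)
    (h4 : ∀ x ∈ U, ∀ h : EuclideanSpace ℝ (Fin (m + 1)), 0 ≤ iteratedFDeriv ℝ 4 ψ x fun _ => h)
    (hN : IsCompact N) (hNc : Convex ℝ N) (hNU : N ⊆ U) (hu : ‖u‖ = 1) {d : ℝ} (hd : 0 < d)
    (hosc : ∀ x ∈ N, ∀ y ∈ N, ⟪u, x⟫ = ⟪u, y⟫ → |ψ x - ψ y| ≤ 1)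
    (hmet : ∀ x ∈ N, ∀ y ∈ N, ∀ z ∈ N, ∀ x' ∈ N, ∀ y' ∈ N, ∀ z' ∈ N, ⟪u, x⟫ = ⟪u, x'⟫ →
      ⟪u, y⟫ = ⟪u, y'⟫ → ⟪u, z⟫ = ⟪u, z'⟫ →
      hessNorm ψ z (y - x) ≤ hessNorm ψ z' (y' - x') + d / 2)
    {S₁ S₂ S₃ : Set (EuclideanSpace ℝ (Fin (m + 1)))} (hcover : N ⊆ S₁ ∪ S₂ ∪ S₃)
    (hdist : ∀ x ∈ S₁ ∩ N, ∀ y ∈ S₂ ∩ N, ENNReal.ofReal d ≤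
      ∫⁻ t in Icc (0 : ℝ) 1, ENNReal.ofReal (hessNorm ψ (x + t • (y - x)) (y - x))) :
    ENNReal.ofReal (d / 4) *
        min (∫⁻ x in S₁ ∩ N, ENNReal.ofReal (Real.exp (-ψ x)))
          (∫⁻ x in S₂ ∩ N, ENNReal.ofReal (Real.exp (-ψ x)))
      ≤ ENNReal.ofReal (Real.exp 4) * ∫⁻ x in S₃ ∩ N, ENNReal.ofReal (Real.exp (-ψ x)) := by
  rcases N.eq_empty_or_nonempty with rfl | hNne
  · simp
  have hinner : Continuous fun x : EuclideanSpace ℝ (Fin (m + 1)) => ⟪u, x⟫ := by fun_prop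
  obtain ⟨xa, hxa, hmin⟩ := hN.exists_isMinOn hNne hinner.continuousOn
  obtain ⟨xb, hxb, hmax⟩ := hN.exists_isMaxOn hNne hinner.continuousOn
  obtain ⟨a, ha⟩ : ∃ a, a = ⟪u, xa⟫ := ⟨_, rfl⟩
  obtain ⟨b, hb⟩ : ∃ b, b = ⟪u, xb⟫ := ⟨_, rfl⟩
  have hrange : ∀ x ∈ N, ⟪u, x⟫ ∈ Icc a b := fun x hx => by
    rw [ha, hb]; exact ⟨hmin hx, hmax hx⟩
  have hab : a ≤ b := (hrange xa hxa).1.trans (hrange xa hxa).2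
  rcases hab.eq_or_lt with hab | hab
  -- a needle without extent in the direction `u` has no volume
  · have hu0 : u ≠ 0 := by rintro rfl; simp at hu
    have hnull : volume (S₁ ∩ N) = 0 := by
      refine measure_mono_null ?_ (volume_inner_eq_zero hu0 a)
      rintro x ⟨-, hx⟩
      have := hrange x hx
      rw [← hab, Icc_self] at this
      exact this
    rw [setLIntegral_measure_zero _ _ hnull]
    simp
  -- the axis `t ↦ p + t • v` of the needle
  obtain ⟨v, hv⟩ : ∃ v, v = (b - a)⁻¹ • (xb - xa) := ⟨_, rfl⟩
  obtain ⟨p, hp⟩ : ∃ p, p = xa - a • v := ⟨_, rfl⟩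
  have hba : 0 < b - a := sub_pos.2 hab
  have huv : ⟪u, v⟫ = 1 := by
    rw [hv, inner_smul_right, inner_sub_right, ← ha, ← hb, inv_mul_cancel₀ hba.ne']
  have hup : ⟪u, p⟫ = 0 := by
    rw [hp, inner_sub_right, inner_smul_right, huv, ← ha]; ring
  have haxis : ∀ t, ⟪u, p + t • v⟫ = t := fun t => by
    rw [inner_add_right, inner_smul_right, huv, hup]; ring
  have hγN : ∀ t ∈ Icc a b, p + t • v ∈ N := by
    intro t ht
    have h1 : 0 ≤ (b - t) / (b - a) := div_nonneg (by linarith [ht.2]) hba.le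
    have h2 : 0 ≤ (t - a) / (b - a) := div_nonneg (by linarith [ht.1]) hba.le
    have := hNc hxa hxb h1 h2 (by field_simp; ring)
    convert this using 1
    rw [hp, hv]
    have e1 : (b - t) / (b - a) = 1 - (t - a) * (b - a)⁻¹ := by field_simp; ring
    rw [e1, div_eq_mul_inv]
    module
  -- the restriction of `ψ` to the axis and its derivatives
  set Φ : ℝ → ℝ := fun t => ψ (p + t • v) with hΦ
  set D : ℕ → ℝ → ℝ := fun k t => iteratedFDeriv ℝ k ψ (p + t • v) fun _ => v with hD
  have hderiv : ∀ k < 4, ∀ t ∈ Icc a b, HasDerivAt (D k) (D (k + 1) t) t := fun k hk t ht =>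
    hasDerivAt_iteratedFDeriv_line hU hψ hk (hNU (hγN t ht))
  have hD0 : D 0 = Φ := by
    ext t; simp [hD, hΦ]
  have hΦc : ConvexOn ℝ (Icc a b) Φ := by
    refine ⟨convex_Icc a b, fun x hx y hy s t hs ht hst => ?_⟩
    have := hψc.2 (hNU (hγN x hx)) (hNU (hγN y hy)) hs ht hst
    have e1 : s • (p + x • v) + t • (p + y • v) = p + (s • x + t • y) • v := by
      have : p = (s + t) • p := by rw [hst, one_smul]
      conv_rhs => rw [this]
      simp only [smul_eq_mul]
      module
    rwa [e1] at this
  have hD2c : ConvexOn ℝ (Icc a b) (D 2) :=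
    convexOn_of_hasDerivWithinAt2_nonneg (convex_Icc a b)
      (fun t ht => (hderiv 2 (by norm_num) t ht).continuousAt.continuousWithinAt)
      (fun t ht => (hderiv 2 (by norm_num) t (interior_subset ht)).hasDerivWithinAt)
      (fun t ht => (hderiv 3 (by norm_num) t (interior_subset ht)).hasDerivWithinAt)
      (fun t ht => h4 _ (hNU (hγN t (interior_subset ht))) _)
  obtain ⟨e, he, heu⟩ := exists_straightening hu
  have heN : IsCompact (e '' N) := hN.image e.continuous
  have heNc : Convex ℝ (e '' N) := hNc.linear_image e.toLinearEquiv.toLinearMap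
  set A : ℝ → ℝ≥0∞ := fun t => volume (Prod.mk t ⁻¹' (e '' N)) with hA
  have hAm : Measurable A := measurable_measure_prodMk_left heN.measurableSet
  set W : ℝ → ℝ≥0∞ := (Icc a b).indicator fun t => ENNReal.ofReal (Real.exp (-Φ t)) with hW
  set ρ : ℝ → ℝ≥0∞ := (Icc a b).indicator fun t => ENNReal.ofReal (Real.exp (-Φ t)) * A t with hρ
  have hρW : ∀ t, ρ t = W t * A t := fun t => indicator_mul_left _ _ _
  have hΦcont : ContinuousOn Φ (Icc a b) := fun t ht => by
    have := (hderiv 0 (by norm_num) t ht).continuousAt.continuousWithinAt (s := Icc a b)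
    rwa [hD0] at this
  have hWm : Measurable W := measurable_indicator_of_continuousOn
    (ENNReal.continuous_ofReal.comp_continuousOn (Real.continuous_exp.comp_continuousOn hΦcont.neg))
    measurableSet_Icc
  have hρm : Measurable ρ := by
    rw [funext hρW]; exact hWm.mul hAm
  set w : EuclideanSpace ℝ (Fin (m + 1)) → ℝ≥0∞ := fun x => ENNReal.ofReal (Real.exp (-ψ x)) with hw
  have hψN : ContinuousOn ψ N := hψ.continuousOn.mono hNU
  have hwc : ContinuousOn w N :=
    ENNReal.continuous_ofReal.comp_continuousOn (Real.continuous_exp.comp_continuousOn hψN.neg)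
  -- oscillation at most `1` costs a factor `exp 1` in the weights
  have hwW : ∀ x ∈ N, w x ≤ ENNReal.ofReal (Real.exp 1) * W ⟪u, x⟫ := by
    intro x hx
    have hx' := hrange x hx
    have := (abs_le.1 (hosc x hx _ (hγN _ hx') (haxis _).symm)).1
    rw [hW, indicator_of_mem hx', ← ENNReal.ofReal_mul (Real.exp_nonneg _), ← Real.exp_add]
    refine ENNReal.ofReal_le_ofReal (Real.exp_le_exp.2 ?_)
    simp only [hΦ]; linarith
  have hWw : ∀ x ∈ N, W ⟪u, x⟫ ≤ ENNReal.ofReal (Real.exp 1) * w x := by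
    intro x hx
    have hx' := hrange x hx
    have := (abs_le.1 (hosc x hx _ (hγN _ hx') (haxis _).symm)).2
    rw [hW, indicator_of_mem hx', ← ENNReal.ofReal_mul (Real.exp_nonneg _), ← Real.exp_add]
    refine ENNReal.ofReal_le_ofReal (Real.exp_le_exp.2 ?_)
    simp only [hΦ]; linarith
  have hρfin : ∫⁻ t, ρ t ≠ ∞ := by
    have h1 := lintegral_sections_le_mul_lintegral he heu hN hwc ENNReal.ofReal_ne_top hWw
      MeasurableSet.univ
    rw [setLIntegral_univ, ← lintegral_congr hρW] at h1
    refine ne_top_of_le_ne_top (ENNReal.mul_ne_top ENNReal.ofReal_ne_top ?_) h1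
    obtain ⟨x₀, -, hx₀⟩ := hN.exists_isMaxOn hNne hwc
    refine ne_top_of_le_ne_top (b := w x₀ * volume N)
      (ENNReal.mul_ne_top ENNReal.ofReal_ne_top hN.measure_lt_top.ne) ?_
    refine (lintegral_mono_set inter_subset_left).trans ?_
    rw [← setLIntegral_const]
    exact setLIntegral_mono' hN.measurableSet fun x hx => hx₀ hx
  -- the metric along the axis
  set f : ℝ → ℝ := (Icc a b).indicator fun t => √(D 2 t) with hf
  have hDc : ContinuousOn (D 2) (Icc a b) := fun t ht =>
    (hderiv 2 (by norm_num) t ht).continuousAt.continuousWithinAt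
  have hfint : Integrable f :=
    (integrable_indicator_iff measurableSet_Icc).2 (hDc.sqrt.integrableOn_Icc)
  have hf0 : ∀ t, 0 ≤ f t := fun t => indicator_nonneg (fun _ _ => Real.sqrt_nonneg _) _
  have hfσ : ∀ t, ENNReal.ofReal (f t)
      = (Icc a b).indicator (fun t => ENNReal.ofReal √(D 2 t)) t := by
    intro t
    by_cases ht : t ∈ Icc a b
    · rw [hf, indicator_of_mem ht, indicator_of_mem ht]
    · rw [hf, indicator_of_notMem ht, indicator_of_notMem ht, ENNReal.ofReal_zero]
  have hfm : Measurable fun t => ENNReal.ofReal (f t) := by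
    rw [funext hfσ]
    exact measurable_indicator_of_continuousOn
      (ENNReal.continuous_ofReal.comp_continuousOn hDc.sqrt) measurableSet_Icc
  have hpt : ∀ s, ENNReal.ofReal (f s) * min (∫⁻ t in Iio s, ρ t) (∫⁻ t in Ioi s, ρ t)
      ≤ ENNReal.ofReal (Real.exp 2) * ρ s := by
    intro s
    rw [hfσ]
    exact sqrt_mul_min_tails_le hΦc
      (fun t ht => by have := hderiv 0 (by norm_num) t ht; rwa [hD0] at this)
      (hderiv 1 (by norm_num)) hD2c (logConcaveOn_volume_section heN heNc _)
      (volume_section_ne_top heN) s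
  have hproj : ∀ s ∈ (fun x => ⟪u, x⟫) '' (S₁ ∩ N), ∀ t ∈ (fun x => ⟪u, x⟫) '' (S₂ ∩ N),
      ENNReal.ofReal (d / 2) ≤ ∫⁻ x in uIoc s t, ENNReal.ofReal (f x) := by
    rintro _ ⟨x, hx, rfl⟩ _ ⟨y, hy, rfl⟩
    have hsI := hrange x hx.2
    have htI := hrange y hy.2
    obtain ⟨s, hs⟩ : ∃ s, s = ⟪u, x⟫ := ⟨_, rfl⟩
    obtain ⟨t, ht⟩ : ∃ t, t = ⟪u, y⟫ := ⟨_, rfl⟩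
    simp only [← hs, ← ht] at hsI htI ⊢
    have hτ : ∀ τ ∈ Icc (0 : ℝ) 1, s + τ * (t - s) ∈ Icc a b := by
      intro τ hτ
      have := (convex_Icc a b) hsI htI (a := 1 - τ) (b := τ) (by linarith [hτ.2]) hτ.1 (by ring)
      convert this using 1
      simp only [smul_eq_mul]; ring
    have hbound : ∀ τ ∈ Icc (0 : ℝ) 1, ENNReal.ofReal (hessNorm ψ (x + τ • (y - x)) (y - x))
        ≤ ENNReal.ofReal |t - s| * ENNReal.ofReal (f (s + τ * (t - s)))
          + ENNReal.ofReal (d / 2) := by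
      intro τ hτI
      have hz : x + τ • (y - x) ∈ N := hNc.add_smul_sub_mem hx.2 hy.2 hτI
      have hzu : ⟪u, x + τ • (y - x)⟫ = s + τ * (t - s) := by
        rw [inner_add_right, inner_smul_right, inner_sub_right, ← hs, ← ht]
      have h1 := hmet x hx.2 y hy.2 _ hz _ (hγN s hsI) _ (hγN t htI) _ (hγN _ (hτ τ hτI))
        (by rw [haxis, hs]) (by rw [haxis, ht]) (by rw [haxis, hzu])
      have e1 : p + t • v - (p + s • v) = (t - s) • v := by module
      rw [e1, hessNorm_smul] at h1
      have e2 : f (s + τ * (t - s)) = hessNorm ψ (p + (s + τ * (t - s)) • v) v := by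
        rw [hf, indicator_of_mem (hτ τ hτI)]; rfl
      rw [← ENNReal.ofReal_mul (abs_nonneg _), e2,
        ← ENNReal.ofReal_add (mul_nonneg (abs_nonneg _) (hessNorm_nonneg _ _)) (by positivity)]
      exact ENNReal.ofReal_le_ofReal h1
    have hle : ENNReal.ofReal d ≤ (∫⁻ r in uIoc s t, ENNReal.ofReal (f r))
        + ENNReal.ofReal (d / 2) := by
      refine (hdist x hx y hy).trans ((setLIntegral_mono' measurableSet_Icc hbound).trans ?_)
      rw [lintegral_add_right _ measurable_const, setLIntegral_const, Real.volume_Icc]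
      simp only [sub_zero, ENNReal.ofReal_one, mul_one]
      refine add_le_add_left ?_ _
      rcases eq_or_ne s t with hst | hst
      · simp [hst]
      have himg := lintegral_image_eq_lintegral_abs_deriv_mul (s := Icc (0 : ℝ) 1)
        (f := fun τ => s + τ * (t - s)) (f' := fun _ => t - s) measurableSet_Icc
        (fun τ _ => by
          have := (((hasDerivAt_id τ).mul_const (t - s)).const_add s).hasDerivWithinAt
            (s := Icc (0 : ℝ) 1)
          simpa using this)
        (fun τ _ τ' _ h => by
          have : (t - s) ≠ 0 := sub_ne_zero.2 hst.symm
          simpa [this] using h)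
        (fun r => ENNReal.ofReal (f r))
      rw [← himg]
      have hsub : (fun τ => s + τ * (t - s)) '' Icc (0 : ℝ) 1 ⊆ uIcc s t := by
        rintro _ ⟨τ, hτ, rfl⟩
        have := (convex_uIcc s t) left_mem_uIcc right_mem_uIcc (a := 1 - τ) (b := τ)
          (by linarith [hτ.2]) hτ.1 (by ring)
        convert this using 1
        simp only [smul_eq_mul]; ring
      refine (lintegral_mono_set hsub).trans (le_of_eq (setLIntegral_congr ?_))
      exact Ioc_ae_eq_Icc.symm
    have hsplit : ENNReal.ofReal d = ENNReal.ofReal (d / 2) + ENNReal.ofReal (d / 2) := by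
      rw [← ENNReal.ofReal_add (by linarith) (by linarith)]; congr 1; ring
    rw [hsplit] at hle
    exact (ENNReal.add_le_add_iff_right ENNReal.ofReal_ne_top).1 hle
  -- closing up makes the projections measurable without decreasing their distance
  set T₁ := closure ((fun x => ⟪u, x⟫) '' (S₁ ∩ N)) with hT₁
  set T₂ := closure ((fun x => ⟪u, x⟫) '' (S₂ ∩ N)) with hT₂
  have hiso := isoperimetry_of_pointwise hρm hfm hρfin hpt
    (isClosed_closure : IsClosed T₁) (isClosed_closure : IsClosed T₂)
    (fun s hs t ht => le_lintegral_uIoc_of_closure hfint hf0 hproj hs ht)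
  have hup : ∀ S : Set (EuclideanSpace ℝ (Fin (m + 1))), ∀ T : Set ℝ, MeasurableSet T →
      (fun x => ⟪u, x⟫) '' (S ∩ N) ⊆ T →
      ∫⁻ x in S ∩ N, w x ≤ ENNReal.ofReal (Real.exp 1) * ∫⁻ t in T, ρ t := by
    intro S T hT hST
    have h1 := lintegral_le_mul_lintegral_sections he heu hN hwc ENNReal.ofReal_ne_top hwW hT
    rw [lintegral_congr hρW]
    have hsub : S ∩ N ⊆ N ∩ {x | ⟪u, x⟫ ∈ T} := fun x hx => ⟨hx.2, hST (mem_image_of_mem _ hx)⟩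
    exact (lintegral_mono_set hsub).trans h1
  have hlow : ∫⁻ t in (T₁ ∪ T₂)ᶜ, ρ t ≤ ENNReal.ofReal (Real.exp 1) * ∫⁻ x in S₃ ∩ N, w x := by
    have h1 := lintegral_sections_le_mul_lintegral he heu hN hwc ENNReal.ofReal_ne_top hWw
      (isClosed_closure.union isClosed_closure : IsClosed (T₁ ∪ T₂)).measurableSet.compl
    rw [lintegral_congr hρW]
    refine h1.trans (mul_le_mul_right (lintegral_mono_set ?_) _)
    rintro x ⟨hx, hxT⟩
    refine ⟨?_, hx⟩
    rcases hcover hx with (h | h) | h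
    · have hxS : x ∈ S₁ ∩ N := ⟨h, hx⟩
      exact absurd (Or.inl (subset_closure (mem_image_of_mem _ hxS))) hxT
    · have hxS : x ∈ S₂ ∩ N := ⟨h, hx⟩
      exact absurd (Or.inr (subset_closure (mem_image_of_mem _ hxS))) hxT
    · exact h
  have hd4 : ENNReal.ofReal (d / 2) / 2 = ENNReal.ofReal (d / 4) := by
    rw [show (2 : ℝ≥0∞) = ENNReal.ofReal 2 by simp, ← ENNReal.ofReal_div_of_pos (by norm_num)]
    congr 1; ring
  rw [hd4] at hiso
  calc ENNReal.ofReal (d / 4) * min (∫⁻ x in S₁ ∩ N, w x) (∫⁻ x in S₂ ∩ N, w x)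
      ≤ ENNReal.ofReal (d / 4) * (ENNReal.ofReal (Real.exp 1) *
          min (∫⁻ t in T₁, ρ t) (∫⁻ t in T₂, ρ t)) := by
        refine mul_le_mul_right ?_ _
        rw [mul_min]
        exact min_le_min (hup S₁ T₁ isClosed_closure.measurableSet subset_closure)
          (hup S₂ T₂ isClosed_closure.measurableSet subset_closure)
    _ = ENNReal.ofReal (Real.exp 1) * (ENNReal.ofReal (d / 4) *
          min (∫⁻ t in T₁, ρ t) (∫⁻ t in T₂, ρ t)) := by ring
    _ ≤ ENNReal.ofReal (Real.exp 1) * (ENNReal.ofReal (Real.exp 2) *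
          (ENNReal.ofReal (Real.exp 1) * ∫⁻ x in S₃ ∩ N, w x)) :=
        mul_le_mul_right (hiso.trans (mul_le_mul_right hlow _)) _
    _ = ENNReal.ofReal (Real.exp 4) * ∫⁻ x in S₃ ∩ N, w x := by
        rw [← mul_assoc, ← mul_assoc, ← ENNReal.ofReal_mul (Real.exp_nonneg _),
          ← ENNReal.ofReal_mul (by positivity), ← Real.exp_add, ← Real.exp_add]
        norm_num

end NeedleEstimate

/-! ### The isoperimetric inequality on compact bodies -/

section Body

open MeasureTheory Set Filter Topology
open scoped RealInnerProductSpace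

/-- The isoperimetric inequality on a compact convex subset of an open set on which `ψ` is smooth,
with the distance replaced by the length of segments: a counterexample could be localized to an
arbitrarily thin needle. -/
theorem compact_isoperimetry {m : ℕ} {U K : Set (EuclideanSpace ℝ (Fin (m + 1)))}
    {ψ : EuclideanSpace ℝ (Fin (m + 1)) → ℝ} (hU : IsOpen U) (hψc : ConvexOn ℝ U ψ)
    (hψ : ContDiffOn ℝ 4 ψ U)
    (h4 : ∀ x ∈ U, ∀ h : EuclideanSpace ℝ (Fin (m + 1)), 0 ≤ iteratedFDeriv ℝ 4 ψ x fun _ => h)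
    (hK : IsCompact K) (hKc : Convex ℝ K) (hKU : K ⊆ U) {d : ℝ} (hd : 0 < d)
    {S₁ S₂ S₃ : Set (EuclideanSpace ℝ (Fin (m + 1)))} (hcover : K ⊆ S₁ ∪ S₂ ∪ S₃)
    (hdist : ∀ x ∈ S₁ ∩ K, ∀ y ∈ S₂ ∩ K, ENNReal.ofReal d ≤
      ∫⁻ t in Icc (0 : ℝ) 1, ENNReal.ofReal (hessNorm ψ (x + t • (y - x)) (y - x))) :
    ENNReal.ofReal (d / 4) *
        min (∫⁻ x in S₁ ∩ K, ENNReal.ofReal (Real.exp (-ψ x)))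
          (∫⁻ x in S₂ ∩ K, ENNReal.ofReal (Real.exp (-ψ x)))
      ≤ ENNReal.ofReal (Real.exp 4) * ∫⁻ x in S₃ ∩ K, ENNReal.ofReal (Real.exp (-ψ x)) := by
  by_contra! hcon
  set w : EuclideanSpace ℝ (Fin (m + 1)) → ℝ≥0∞ := fun x => ENNReal.ofReal (Real.exp (-ψ x)) with hw
  have hψK : ContinuousOn ψ K := hψ.continuousOn.mono hKU
  have hwc : ContinuousOn w K :=
    ENNReal.continuous_ofReal.comp_continuousOn (Real.continuous_exp.comp_continuousOn hψK.neg)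
  have hwm : Measurable (K.indicator w) :=
    measurable_indicator_of_continuousOn hwc hK.measurableSet
  have hKne : K.Nonempty := by
    by_contra hne
    rw [not_nonempty_iff_eq_empty] at hne
    simp [hne] at hcon
  obtain ⟨x₀, -, hx₀⟩ := hK.exists_isMaxOn hKne hwc
  -- the mass of `S ∩ N` as a measure in `N`
  set μ : Set (EuclideanSpace ℝ (Fin (m + 1))) → Measure (EuclideanSpace ℝ (Fin (m + 1))) :=
    fun S => (volume.restrict (S ∩ K)).withDensity (K.indicator w) with hμ
  have hμac : ∀ S, μ S ≪ volume := fun S =>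
    (withDensity_absolutelyContinuous _ _).trans Measure.restrict_le_self.absolutelyContinuous
  have hμN : ∀ S, ∀ N ⊆ K, MeasurableSet N → μ S N = ∫⁻ x in S ∩ N, w x := by
    intro S N hNK hN
    have e1 : N ∩ (S ∩ K) = S ∩ N := by
      ext x; simp only [mem_inter_iff]
      exact ⟨fun h => ⟨h.2.1, h.1⟩, fun h => ⟨h.2, h.1, hNK h.2⟩⟩
    rw [hμ, withDensity_apply _ hN, Measure.restrict_restrict hN, e1]
    refine lintegral_congr_ae ?_
    have : ∀ᵐ x ∂(volume.restrict (S ∩ N)), x ∈ K :=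
      ae_mono (Measure.restrict_mono (inter_subset_right.trans hNK) le_rfl)
        (ae_restrict_mem hK.measurableSet)
    filter_upwards [this] with x hx
    rw [indicator_of_mem hx]
  have hμfin : ∀ S, IsFiniteMeasure (μ S) := by
    intro S
    refine isFiniteMeasure_withDensity (ne_top_of_le_ne_top (b := w x₀ * volume K)
      (ENNReal.mul_ne_top ENNReal.ofReal_ne_top hK.measure_lt_top.ne) ?_)
    calc ∫⁻ x in S ∩ K, K.indicator w x ≤ ∫⁻ _ in S ∩ K, w x₀ := by
          refine lintegral_mono fun x => ?_
          by_cases hx : x ∈ K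
          · rw [indicator_of_mem hx]; exact hx₀ hx
          · rw [indicator_of_notMem hx]; exact zero_le
      _ ≤ w x₀ * volume K := by
          rw [setLIntegral_const]
          exact mul_le_mul_right (measure_mono inter_subset_right) _
  have fin1 : ∀ (c : ℝ) S, IsFiniteMeasure (ENNReal.ofReal c • μ S) := fun c S =>
    Measure.smul_finite _ ENNReal.ofReal_ne_top
  have ac1 : ∀ (c : ℝ) S, ENNReal.ofReal c • μ S ≪ volume := fun c S =>
    Measure.smul_absolutelyContinuous.trans (hμac S)
  have hunb : IsUnbalanced (ENNReal.ofReal (d / 4) • μ S₁) (ENNReal.ofReal (d / 4) • μ S₂)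
      (ENNReal.ofReal (Real.exp 4) • μ S₃) K := by
    rw [mul_min, lt_min_iff] at hcon
    refine ⟨hK, hKc, ?_, ?_⟩ <;>
      simp only [Measure.smul_apply, smul_eq_mul, hμN _ K subset_rfl hK.measurableSet]
    exacts [hcon.1, hcon.2]
  -- the thinness below which `ψ` and its metric are almost constant on sections
  obtain ⟨δ₁, hδ₁, hψunif⟩ := Metric.uniformContinuousOn_iff_le.1
    (hK.uniformContinuousOn_of_continuous hψK) 1 one_pos
  obtain ⟨R, hR⟩ := Metric.isBounded_iff.1 hK.isBounded
  have hcomp : IsCompact (K ×ˢ Metric.closedBall (0 : EuclideanSpace ℝ (Fin (m + 1))) R) :=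
    hK.prod (isCompact_closedBall _ _)
  obtain ⟨δ₂, hδ₂, hhunif⟩ := Metric.uniformContinuousOn_iff_le.1
    (hcomp.uniformContinuousOn_of_continuous
      ((continuousOn_hessNorm hU hψ).mono (prod_mono hKU (subset_univ _)))) (d / 2) (by linarith)
  obtain ⟨N, hNK, hN, u, hu, hthin⟩ := hunb.exists_needle (ac1 _ _) (ac1 _ _) (ac1 _ _) (by simp)
    (lt_min hδ₁ (half_pos hδ₂))
  have hball : ∀ x ∈ N, ∀ y ∈ N, y - x ∈ Metric.closedBall (0 : EuclideanSpace ℝ (Fin (m + 1))) R :=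
    fun x hx y hy => by
      rw [mem_closedBall_zero_iff, ← dist_eq_norm]; exact hR (hNK hy) (hNK hx)
  have key := needle_isoperimetry (N := N) hU hψc hψ h4 hN.isCompact hN.convex (hNK.trans hKU) hu hd
    (fun x hx y hy hxy => by
      have := hψunif x (hNK hx) y (hNK hy)
        (by rw [dist_eq_norm]; exact (hthin x hx y hy hxy).trans (min_le_left _ _))
      rwa [Real.dist_eq] at this)
    (fun x hx y hy z hz x' hx' y' hy' z' hz' hxx hyy hzz => by
      have hδ : ∀ a ∈ N, ∀ b ∈ N, ⟪u, a⟫ = ⟪u, b⟫ → ‖a - b‖ ≤ δ₂ / 2 := fun a ha b hb hab =>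
        (hthin a ha b hb hab).trans (min_le_right _ _)
      have h1 := hhunif (z, y - x) ⟨hNK hz, hball x hx y hy⟩ (z', y' - x')
        ⟨hNK hz', hball x' hx' y' hy'⟩ (by
          rw [Prod.dist_eq, max_le_iff, dist_eq_norm, dist_eq_norm]
          refine ⟨(hδ z hz z' hz' hzz).trans (by linarith), ?_⟩
          have e1 : y - x - (y' - x') = (y - y') - (x - x') := by abel
          simp only [e1]
          have := norm_sub_le (y - y') (x - x')
          linarith [hδ y hy y' hy' hyy, hδ x hx x' hx' hxx])
      rw [Real.dist_eq] at h1
      have := (abs_le.1 h1).2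
      simp only at this
      linarith)
    (hNK.trans hcover)
    (fun x hx y hy => hdist x ⟨hx.1, hNK hx.2⟩ y ⟨hy.1, hNK hy.2⟩)
  refine not_lt.2 key ?_
  have l1 := hN.lt_left
  have l2 := hN.lt_right
  simp only [Measure.smul_apply, smul_eq_mul, hμN _ N hNK hN.isCompact.measurableSet] at l1 l2
  rw [mul_min, lt_min_iff]
  exact ⟨l1, l2⟩

/-! ### Exhaustion of a convex body -/

/-- The interior of a bounded convex set is the union of an increasing sequence of compact convex
sets, namely homothetic copies of the closure. -/
lemma exists_compact_convex_exhaustion {E : Type*} [NormedAddCommGroup E] [NormedSpace ℝ E]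
    [FiniteDimensional ℝ E] {K : Set E} (hK : Convex ℝ K) (hb : Bornology.IsBounded K)
    (hne : (interior K).Nonempty) :
    ∃ L : ℕ → Set E, Monotone L ∧ (∀ j, IsCompact (L j) ∧ Convex ℝ (L j) ∧ L j ⊆ interior K) ∧
      interior K ⊆ ⋃ j, L j := by
  obtain ⟨p, hp⟩ := hne
  set θ : ℕ → ℝ := fun j => ((j + 1 : ℕ) : ℝ) / ((j + 1 : ℕ) + 1) with hθ
  have hθ0 : ∀ j, 0 < θ j := fun j => by positivity
  have hθ1 : ∀ j, θ j < 1 := fun j => by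
    rw [hθ]; simp only; rw [div_lt_one (by positivity)]; linarith
  have hθlim : Tendsto θ atTop (𝓝 1) :=
    (tendsto_natCast_div_add_atTop (1 : ℝ)).comp (tendsto_add_atTop_nat 1)
  have hθmono : Monotone θ := by
    refine monotone_nat_of_le_succ fun j => ?_
    rw [hθ]; simp only
    rw [div_le_div_iff₀ (by positivity) (by positivity)]
    push_cast
    nlinarith
  have himg : ∀ j x, (1 - θ j) • p + θ j • x = p + θ j • (x - p) := fun j x => by module
  refine ⟨fun j => (fun x => (1 - θ j) • p + θ j • x) '' closure K, ?_, fun j => ⟨?_, ?_, ?_⟩, ?_⟩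
  · rintro i j hij _ ⟨x, hx, rfl⟩
    refine ⟨(1 - θ i / θ j) • p + (θ i / θ j) • x, ?_, ?_⟩
    · have h1 : θ i / θ j ≤ 1 := (div_le_one (hθ0 j)).2 (hθmono hij)
      exact hK.closure (subset_closure (interior_subset hp)) hx (by linarith)
        (div_pos (hθ0 i) (hθ0 j)).le (by ring)
    · simp only [smul_add, smul_smul, mul_sub, mul_div_cancel₀ _ (hθ0 j).ne', mul_one]
      module
  · exact hb.isCompact_closure.image (by fun_prop)
  · rintro _ ⟨x, hx, rfl⟩ _ ⟨y, hy, rfl⟩ a b ha hb' hab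
    refine ⟨a • x + b • y, hK.closure hx hy ha hb' hab, ?_⟩
    calc (1 - θ j) • p + θ j • (a • x + b • y)
        = (a + b) • (1 - θ j) • p + θ j • (a • x + b • y) := by rw [hab, one_smul]
      _ = _ := by module
  · rintro _ ⟨x, hx, rfl⟩
    exact hK.combo_interior_closure_mem_interior hp hx (by linarith [hθ1 j]) (hθ0 j).le (by ring)
  · intro x hx
    have hc : Tendsto (fun j => p + (θ j)⁻¹ • (x - p)) atTop (𝓝 (p + (1 : ℝ)⁻¹ • (x - p))) :=
      ((hθlim.inv₀ one_ne_zero).smul_const _).const_add _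
    have e1 : p + (1 : ℝ)⁻¹ • (x - p) = x := by simp
    rw [e1] at hc
    obtain ⟨j, hj⟩ := (hc.eventually (mem_interior_iff_mem_nhds.1 hx)).exists
    refine mem_iUnion.2 ⟨j, _, subset_closure hj, ?_⟩
    simp only
    rw [himg, add_sub_cancel_left, smul_smul, mul_inv_cancel₀ (hθ0 j).ne', one_smul]
    abel

lemma iteratedFDerivWithin_eq_of_mem_interior {E : Type*} [NormedAddCommGroup E] [NormedSpace ℝ E]
    {φ : E → ℝ} {K : Set E} {z : E} (hz : z ∈ interior K) (k : ℕ) :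
    iteratedFDerivWithin ℝ k φ K z = iteratedFDeriv ℝ k φ z := by
  rw [iteratedFDerivWithin_congr_set
    (eventuallyEq_univ.2 (mem_interior_iff_mem_nhds.1 hz)), iteratedFDerivWithin_univ]

/-- The Riemannian distance is at most the length of the segment. -/
lemma hessianDist_le_segment {n : ℕ} {φ : EuclideanSpace ℝ (Fin n) → ℝ}
    {K : Set (EuclideanSpace ℝ (Fin n))} (hK : Convex ℝ K) {x y : EuclideanSpace ℝ (Fin n)}
    (hx : x ∈ interior K) (hy : y ∈ interior K) :
    hessianDist φ K x y
      ≤ ∫⁻ t in Icc (0 : ℝ) 1, ENNReal.ofReal (hessNorm φ (x + t • (y - x)) (y - x)) := by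
  have hder : ∀ t : ℝ, HasDerivAt (fun t : ℝ => x + t • (y - x)) (y - x) t := fun t => by
    simpa using ((hasDerivAt_id t).smul_const (y - x)).const_add x
  have hcurve : IsCurveIn K x y fun t : ℝ => x + t • (y - x) :=
    { contDiffOn := by fun_prop
      mapsTo := fun t ht =>
        hK.add_smul_sub_mem (interior_subset hx) (interior_subset hy) ht
      source := by simp
      target := by simp }
  refine (iInf₂_le _ hcurve).trans ?_
  refine setLIntegral_mono' measurableSet_Icc fun t ht => le_of_eq ?_
  rw [(hder t).hasDerivWithinAt.derivWithin (uniqueDiffOn_Icc one_pos t ht), hessianNorm,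
    iteratedFDerivWithin_eq_of_mem_interior (hK.interior.add_smul_sub_mem hx hy ht), hessNorm]

lemma lintegral_inter_interior_eq {n : ℕ} {K S : Set (EuclideanSpace ℝ (Fin n))}
    (hK : Convex ℝ K) (hS : S ⊆ K) (w : EuclideanSpace ℝ (Fin n) → ℝ≥0∞) :
    ∫⁻ x in S ∩ interior K, w x = ∫⁻ x in S, w x := by
  refine setLIntegral_congr ?_
  have h1 : S \ frontier K = S ∩ interior K := by
    ext x
    simp only [Set.mem_sdiff, mem_inter_iff, frontier]
    constructor
    · rintro ⟨hx, h⟩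
      exact ⟨hx, by_contra fun h' => h ⟨subset_closure (hS hx), h'⟩⟩
    · rintro ⟨hx, h⟩
      exact ⟨hx, fun h' => h'.2 h⟩
  rw [← h1]
  exact sdiff_null_ae_eq_self (hK.addHaar_frontier volume)

end Body

end HessianIsoperimetry

open HessianIsoperimetry in
theorem mainTheorem5 :
    ∃ C : ℝ, 0 < C ∧
      ∀ (n : ℕ) (K : Set (EuclideanSpace ℝ (Fin n))) (φ : EuclideanSpace ℝ (Fin n) → ℝ),
        HessianIsoperimetry.IsConvexBody K →
        ConvexOn ℝ K φ →
        ContDiffOn ℝ 4 φ K →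
        (∀ x ∈ K, ∀ h : EuclideanSpace ℝ (Fin n),
          0 ≤ iteratedFDerivWithin ℝ 4 φ K x (fun _ => h)) →
        ∀ S₁ S₂ S₃ : Set (EuclideanSpace ℝ (Fin n)),
          MeasureTheory.NullMeasurableSet S₁ MeasureTheory.volume →
          MeasureTheory.NullMeasurableSet S₂ MeasureTheory.volume →
          MeasureTheory.NullMeasurableSet S₃ MeasureTheory.volume →
          S₁ ∪ S₂ ∪ S₃ = K →
          Disjoint S₁ S₂ → Disjoint S₁ S₃ → Disjoint S₂ S₃ →
          ∀ α : ℝ, 0 < α →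
            ENNReal.ofReal (C * Real.sqrt α) * HessianIsoperimetry.hessianSetDist φ K S₁ S₂ *
                min (HessianIsoperimetry.gibbsMass φ α S₁) (HessianIsoperimetry.gibbsMass φ α S₂)
              ≤ HessianIsoperimetry.gibbsMass φ α S₃ := by
  refine ⟨(4 * Real.exp 4)⁻¹, by positivity, ?_⟩
  intro n K φ hK hφc hφ h4 S₁ S₂ S₃ _ _ _ hcover h₁₂ _ _ α hα
  rcases n with _ | m
  -- in dimension zero the body is a point, so that `S₁` or `S₂` is empty
  · have hempty : S₁ = ∅ ∨ S₂ = ∅ := by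
      by_contra! h
      obtain ⟨⟨x, hx⟩, y, hy⟩ := h
      exact Set.disjoint_left.1 h₁₂ hx (Subsingleton.elim x y ▸ hy)
    rcases hempty with rfl | rfl <;> simp [gibbsMass]
  have hS₁K : S₁ ⊆ K := hcover ▸ fun x hx => Or.inl (Or.inl hx)
  have hS₂K : S₂ ⊆ K := hcover ▸ fun x hx => Or.inl (Or.inr hx)
  set U := interior K with hU
  set ψ : EuclideanSpace ℝ (Fin (m + 1)) → ℝ := α • φ with hψ
  have hφU : ContDiffOn ℝ 4 φ U := hφ.mono interior_subset
  have hiter : ∀ k ≤ 4, ∀ z ∈ U, iteratedFDeriv ℝ k ψ z = α • iteratedFDeriv ℝ k φ z := by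
    intro k hk z hz
    exact iteratedFDeriv_const_smul_apply
      ((hφU.contDiffAt (isOpen_interior.mem_nhds hz)).of_le (by exact_mod_cast hk))
  have hnorm : ∀ z ∈ U, ∀ v, hessNorm ψ z v = √α * hessNorm φ z v := by
    intro z hz v
    rw [hessNorm, hiter 2 (by norm_num) z hz, smul_apply, smul_eq_mul,
      Real.sqrt_mul hα.le, hessNorm]
  have hψ4 : ∀ x ∈ U, ∀ h : EuclideanSpace ℝ (Fin (m + 1)),
      0 ≤ iteratedFDeriv ℝ 4 ψ x fun _ => h := by
    intro x hx h
    rw [hiter 4 le_rfl x hx, ← iteratedFDerivWithin_eq_of_mem_interior hx]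
    exact mul_nonneg hα.le (h4 x (interior_subset hx) h)
  have hψc : ConvexOn ℝ U ψ :=
    (hφc.subset interior_subset hK.convex.interior).smul hα.le
  have hψU : ContDiffOn ℝ 4 ψ U := hφU.const_smul α
  set D : ENNReal := ENNReal.ofReal √α * hessianSetDist φ K S₁ S₂ with hD
  have hdist : ∀ x ∈ S₁ ∩ U, ∀ y ∈ S₂ ∩ U, D ≤ ∫⁻ t in Set.Icc (0 : ℝ) 1,
      ENNReal.ofReal (hessNorm ψ (x + t • (y - x)) (y - x)) := by
    intro x hx y hy
    have h1 : hessianSetDist φ K S₁ S₂ ≤ hessianDist φ K x y :=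
      (iInf₂_le x hx.1).trans (iInf₂_le y hy.1)
    have h2 := h1.trans (hessianDist_le_segment (φ := φ) hK.convex hx.2 hy.2)
    refine (mul_le_mul_right h2 _).trans ?_
    rw [← MeasureTheory.lintegral_const_mul' _ _ ENNReal.ofReal_ne_top]
    refine MeasureTheory.setLIntegral_mono' measurableSet_Icc fun t ht => le_of_eq ?_
    rw [hnorm _ (hK.convex.interior.add_smul_sub_mem hx.2 hy.2 ht),
      ENNReal.ofReal_mul (Real.sqrt_nonneg _)]
  obtain ⟨L, hLmono, hL, hLU⟩ := exists_compact_convex_exhaustion hK.convex hK.bounded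
    hK.nonempty_interior
  have hLeq : (⋃ j, L j) = U := Set.Subset.antisymm (Set.iUnion_subset fun j => (hL j).2.2) hLU
  have hlim : ∀ S ⊆ K, Filter.Tendsto
      (fun j => ∫⁻ x in S ∩ L j, ENNReal.ofReal (Real.exp (-ψ x))) Filter.atTop
      (nhds (gibbsMass φ α S)) := by
    intro S hS
    have hmono : Monotone fun j => S ∩ L j := fun i j hij =>
      Set.inter_subset_inter_right _ (hLmono hij)
    have h1 := tendsto_atTop_iSup (f := fun j => ∫⁻ x in S ∩ L j, ENNReal.ofReal (Real.exp (-ψ x)))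
      fun i j hij => MeasureTheory.lintegral_mono_set (hmono hij)
    rwa [← MeasureTheory.setLIntegral_iUnion_of_directed _ hmono.directed_le, ← Set.inter_iUnion,
      hLeq, lintegral_inter_interior_eq hK.convex hS] at h1
  have hreal : ∀ d : ℝ, 0 < d → ENNReal.ofReal d ≤ D → ENNReal.ofReal (d / 4) *
      min (gibbsMass φ α S₁) (gibbsMass φ α S₂)
        ≤ ENNReal.ofReal (Real.exp 4) * gibbsMass φ α S₃ := by
    intro d hd hdD
    refine le_of_tendsto' (ENNReal.Tendsto.const_mul ((hlim S₁ hS₁K).min (hlim S₂ hS₂K))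
      (Or.inr ENNReal.ofReal_ne_top)) fun j => ?_
    refine (compact_isoperimetry isOpen_interior hψc hψU hψ4 (hL j).1 (hL j).2.1 (hL j).2.2 hd
      (S₃ := S₃) (((hL j).2.2.trans interior_subset).trans hcover.ge)
      (fun x hx y hy => hdD.trans (hdist x ⟨hx.1, (hL j).2.2 hx.2⟩ y
        ⟨hy.1, (hL j).2.2 hy.2⟩))).trans ?_
    exact mul_le_mul_right (MeasureTheory.lintegral_mono_set Set.inter_subset_left) _
  have hmain : D * min (gibbsMass φ α S₁) (gibbsMass φ α S₂)
      ≤ ENNReal.ofReal (4 * Real.exp 4) * gibbsMass φ α S₃ := by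
    refine ENNReal.mul_le_of_forall_lt fun a ha b hb => ?_
    rcases eq_or_ne a 0 with rfl | ha0
    · simp
    have hat : a ≠ ⊤ := ha.ne_top
    have h1 := hreal a.toReal (ENNReal.toReal_pos ha0 hat)
      (by rw [ENNReal.ofReal_toReal hat]; exact ha.le)
    calc a * b ≤ a * min (gibbsMass φ α S₁) (gibbsMass φ α S₂) := mul_le_mul_right hb.le _
      _ = ENNReal.ofReal 4 * (ENNReal.ofReal (a.toReal / 4) *
            min (gibbsMass φ α S₁) (gibbsMass φ α S₂)) := by
          rw [← mul_assoc, ← ENNReal.ofReal_mul (by norm_num), mul_div_cancel₀ _ (by norm_num),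
            ENNReal.ofReal_toReal hat]
      _ ≤ _ := by
          rw [ENNReal.ofReal_mul (by norm_num), mul_assoc]
          exact mul_le_mul_right h1 _
  calc ENNReal.ofReal ((4 * Real.exp 4)⁻¹ * √α) * hessianSetDist φ K S₁ S₂ *
        min (gibbsMass φ α S₁) (gibbsMass φ α S₂)
      = ENNReal.ofReal (4 * Real.exp 4)⁻¹ * (D * min (gibbsMass φ α S₁) (gibbsMass φ α S₂)) := by
        rw [ENNReal.ofReal_mul (by positivity), hD]; ring
    _ ≤ ENNReal.ofReal (4 * Real.exp 4)⁻¹ *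
          (ENNReal.ofReal (4 * Real.exp 4) * gibbsMass φ α S₃) := mul_le_mul_right hmain _
    _ = gibbsMass φ α S₃ := by
        rw [← mul_assoc, ← ENNReal.ofReal_mul (by positivity), inv_mul_cancel₀ (by positivity),
          ENNReal.ofReal_one, one_mul]
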